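/- Let $V=\mathbb C^5$ with standard basis $e_1,\dots,e_5$ and dual basis $e_1^\vee,\dots,e_5^\vee$, let $L=\mathbb C$, and let $G=\mathrm{GL}(5)\times\mathbb C^\times$ act on $V$ in the standard way through the first factor and on $L$ by scalar multiplication through the second. Put $D=\bigwedge^5V\otimes L^{2}$ (tensor powers of $L$ and $D$ are written as powers). Let $\mathbb A^{10}=\operatorname{Spec}\mathcal O$ with $\mathcal O=\operatorname{Sym}(\bigwedge^2V\otimes L)$ be the affine space whose linear coordinate functions $x_{ij}=e_i\wedge e_j\otimes 1$ form the representation $\bigwedge^2V\otimes L$; its closed points are the linear maps $\bigwedge^2V\otimes L\to\mathbb C$, and $G$ acts on $\mathcal O$ by the induced algebra automorphisms. Let $\mathrm{aGr}(2,5)\subset\mathbb A^{10}$ be the affine cone over the Grassmannian: the set of points of the form $x_{ij}=a_ib_j-a_jb_i$ with $a,b\in\mathbb C^5$. Let $I\subset\mathcal O$ be the ideal of all functions vanishing on it and $\mathcal O_{\mathrm{aGr}}=\mathcal O/I$; it carries the induced $G$-action. A $G$-equivariant $\mathcal O$-module is an $\mathcal O$-module $F$ with a representation of $G$ such that $g(am)=g(a)g(m)$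 for $g\in G$, $a\in\mathcal O$, $m\in F$. Define the following maps. * The universal map $M\colon V\otimes L\to\mathcal O\otimes V^\vee$, $v\otimes l\mapsto\sum_i(e_i\wedge v\otimes l)\otimes e_i^\vee$ (so $v\otimes l$ goes to the linear form $w\mapsto w\wedge v\otimes l$ on $V$ with values in $\mathcal O$). * $\mathrm{Pf}\colon V^\vee\otimes D\to\mathcal O$, the composite of the contraction $V^\vee\otimes D\to\bigwedge^4V\otimes L^2$, $\varphi\otimes(v_1\wedge\dots\wedge v_5)\otimes s\mapsto\sum_i(-1)^{i-1}\varphi(v_i)\,v_1\wedge\dots\widehat{v_i}\dots\wedge v_5\otimes s$, and the map $v_1\wedge v_2\wedge v_3\wedge v_4\otimes l\otimes l'\mapsto ll'\,(x(v_1,v_2)x(v_3,v_4)-x(v_1,v_3)x(v_2,v_4)+x(v_1,v_4)x(v_2,v_3))$, where $x(v,w)=v\wedge w\otimes1\in\mathcal O$. * ${}^t\mathrm{Pf}\colon L\otimes D^2\to\mathcal O\otimes V\otimes L\otimes D$, $l\otimes d\otimes d'\mapsto\sum_i\mathrm{Pf}(e_i^\vee\otimes d)\otimes e_i\otimes l\otimes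 d'$. Extended $\mathcal O$-linearly, and with $M$ tensored with $D$, they give $$0\leftarrow\mathcal O_{\mathrm{aGr}}\leftarrow\mathcal O\xleftarrow{\ \mathrm{Pf}\ }\mathcal O\otimes V^\vee\otimes D\xleftarrow{\ M\ }\mathcal O\otimes V\otimes L\otimes D\xleftarrow{\ {}^t\mathrm{Pf}\ }\mathcal O\otimes L\otimes D^2\leftarrow0,\qquad(*)$$ where $\mathcal O\to\mathcal O_{\mathrm{aGr}}$ is the quotient map. Then: 1. For all $v,w\in V$ and $l\in L$, evaluating the $V^\vee$ factor of $M(v\otimes l)$ at $w$ gives $w\wedge v\otimes l\in\mathcal O$. The contraction $V^\vee\otimes D\to\bigwedge^4V\otimes L^2$ is a $G$-equivariant isomorphism. The alternating form $x(v_1,v_2)x(v_3,v_4)-x(v_1,v_3)x(v_2,v_4)+x(v_1,v_4)x(v_2,v_3)$ is one half of the wedge square of the universal skew form $x$. 2. In the standard bases, $M$ is the generic skew matrix $(x_{ij})$, $\mathrm{Pf}$ is the vector $(\mathrm{Pf}_1,\dots,\mathrm{Pf}_5)$, where $\mathrm{Pf}_i$ is $(-1)^{i-1}$ times the $4\times4$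 Pfaffian of $(x_{ij})$ with the $i$-th row and column omitted, and ${}^t\mathrm{Pf}$ is the transposed vector. 3. All terms of $(*)$ are $G$-equivariant $\mathcal O$-modules; the three modules $\mathcal O\otimes V^\vee\otimes D$, $\mathcal O\otimes V\otimes L\otimes D$, $\mathcal O\otimes L\otimes D^2$ are free of ranks $5,5,1$; all maps of $(*)$ are $\mathcal O$-linear and $G$-equivariant; and $(*)$ is exact. Thus $(*)$ is a $G$-equivariant free resolution of $\mathcal O_{\mathrm{aGr}}$. 4. In particular $I=(\mathrm{Pf}_1,\dots,\mathrm{Pf}_5)$, and $M$ gives the syzygies: $c\in\mathcal O^5$ satisfies $\sum_ic_i\,\mathrm{Pf}_i=0$ if and only if $c=(x_{ij})\,b$ for some $b\in\mathcal O^5$. -/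

import Mathlib

open scoped TensorProduct

noncomputable section

namespace AffGr

/-! ### The group, its representations, and the ambient affine space -/

/-- `V = ℂ⁵`. -/
abbrev V : Type := Fin 5 → ℂ

/-- `L = ℂ`. -/
abbrev L : Type := ℂ

/-- `G = GL(5) × ℂˣ`. -/
abbrev G : Type := GL (Fin 5) ℂ × ℂˣ

/-- The `n`-th exterior power of `V`. -/
abbrev Ext (n : ℕ) : Type := ⋀[ℂ]^n V

/-- The one-dimensional representation `D = ⋀⁵V ⊗ L²`. -/
abbrev D : Type := Ext 5 ⊗[ℂ] (L ⊗[ℂ] L)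

/-- The linear functions on the ambient affine space: `⋀²V ⊗ L`. -/
abbrev Lin : Type := Ext 2 ⊗[ℂ] L

/-- The coordinate ring `Sym(⋀²V ⊗ L)` of the ten-dimensional ambient affine space. -/
abbrev O : Type := SymmetricAlgebra ℂ Lin

/-- The standard action of `G` on `V`, through `GL(5)`. -/
def rhoV : Representation ℂ G V where
  toFun g := Matrix.mulVecLin (g.1 : Matrix (Fin 5) (Fin 5) ℂ)
  map_one' := by ext; simp
  map_mul' g h := by
    simp [Matrix.mulVecLin_mul, Module.End.mul_eq_comp]

/-- The action of `G` on `L`: scalar multiplication through `ℂˣ`. -/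
def rhoL : Representation ℂ G L where
  toFun g := (g.2 : ℂ) • LinearMap.id
  map_one' := by ext; simp
  map_mul' g h := by ext; simp [mul_comm]

/-- The action of `G` on `⋀ⁿV`. -/
def rhoExt (n : ℕ) : Representation ℂ G (Ext n) where
  toFun g := exteriorPower.map n (rhoV g)
  map_one' := by
    rw [map_one]; exact exteriorPower.map_id
  map_mul' g h := by
    rw [map_mul, Module.End.mul_eq_comp, Module.End.mul_eq_comp, exteriorPower.map_comp]

/-- The action of `G` on `D`. -/
def rhoD : Representation ℂ G D := (rhoExt 5).tprod (rhoL.tprod rhoL)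

/-- The action of `G` on `⋀²V ⊗ L`. -/
def rhoLin : Representation ℂ G Lin := (rhoExt 2).tprod rhoL

/-- The action of `G` on the coordinate ring by algebra automorphisms, extending the one on
the linear functions. -/
def actO : G →* (O →ₐ[ℂ] O) where
  toFun g := SymmetricAlgebra.lift (SymmetricAlgebra.ι ℂ Lin ∘ₗ rhoLin g)
  map_one' := by
    apply SymmetricAlgebra.algHom_ext
    ext x
    simp
  map_mul' g h := by
    apply SymmetricAlgebra.algHom_ext
    apply LinearMap.ext
    intro x
    simp

/-- The same action, as a representation. -/
def rhoO : Representation ℂ G O where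
  toFun g := (actO g).toLinearMap
  map_one' := by rw [map_one]; rfl
  map_mul' g h := by rw [map_mul]; rfl

/-! ### Points of the affine space and the affine Grassmannian -/

/-- The (closed) points of the affine space `Spec O`: the linear forms `⋀²V ⊗ L → ℂ`, that is,
the skew forms on `V` with values in the dual of `L`. -/
abbrev Pt : Type := Module.Dual ℂ Lin

/-- The value at a point of a function on the affine space. -/
def evalPt (p : Pt) : O →ₐ[ℂ] ℂ := SymmetricAlgebra.lift p

/-- The decomposable element `v ∧ w` of `⋀²V`. -/
def wedge (v w : V) : Ext 2 := exteriorPower.ιMulti ℂ 2 ![v, w]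

/-- The affine cone over `Gr(2,5)`: the skew forms of rank at most two, that is, those of the
form `a ∧ b` (in coordinates, `x_ij = a_i b_j - a_j b_i`). -/
def aGr : Set Pt :=
  {p | ∃ a b : Module.Dual ℂ V, ∀ (v w : V) (l : L),
    p (wedge v w ⊗ₜ[ℂ] l) = (a v * b w - a w * b v) * l}

/-- The ideal of all functions vanishing on the affine cone. -/
def idealGr : Ideal O where
  carrier := {f | ∀ p ∈ aGr, evalPt p f = 0}
  add_mem' hf hg p hp := by simp [hf p hp, hg p hp]
  zero_mem' p _ := by simp
  smul_mem' c f hf p hp := by simp [hf p hp]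

/-- The coordinate ring of the affine cone (the global sections of its structure sheaf). -/
abbrev OGr : Type := O ⧸ idealGr

theorem evalPt_actO (g : G) (p : Pt) (f : O) :
    evalPt p (actO g f) = evalPt (rhoLin.dual g⁻¹ p) f := by
  have h : (evalPt p).comp (actO g) = evalPt (rhoLin.dual g⁻¹ p) := by
    apply SymmetricAlgebra.algHom_ext
    apply LinearMap.ext
    intro x
    simp [evalPt, actO, Representation.dual_apply, Module.Dual.transpose_apply]
  exact congrArg (fun F : O →ₐ[ℂ] ℂ => F f) h

theorem rhoLin_wedge (g : G) (v w : V) (l : L) :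
    rhoLin g (wedge v w ⊗ₜ[ℂ] l) = wedge (rhoV g v) (rhoV g w) ⊗ₜ[ℂ] rhoL g l := by
  simp only [rhoLin, Representation.tprod_apply, TensorProduct.map_tmul, wedge]
  congr 1
  change exteriorPower.map 2 (rhoV g) _ = _
  rw [exteriorPower.map_apply_ιMulti]
  congr 1
  ext i
  fin_cases i <;> rfl

theorem dual_mem_aGr (g : G) (p : Pt) (hp : p ∈ aGr) : rhoLin.dual g p ∈ aGr := by
  obtain ⟨a, b, h⟩ := hp
  refine ⟨((g⁻¹).2 : ℂ) • a ∘ₗ rhoV g⁻¹, b ∘ₗ rhoV g⁻¹, fun v w l => ?_⟩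
  have : rhoLin.dual g p (wedge v w ⊗ₜ[ℂ] l) = p (rhoLin g⁻¹ (wedge v w ⊗ₜ[ℂ] l)) := rfl
  rw [this, rhoLin_wedge, h]
  have hl : rhoL g⁻¹ l = ((g⁻¹).2 : ℂ) * l := rfl
  simp only [LinearMap.smul_apply, LinearMap.comp_apply, smul_eq_mul, hl]
  ring

theorem actO_mem_idealGr (g : G) (f : O) (hf : f ∈ idealGr) : actO g f ∈ idealGr := by
  intro p hp
  rw [evalPt_actO]
  exact hf _ (dual_mem_aGr _ _ hp)

/-- The action of `G` on the coordinate ring of the affine cone. -/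
def rhoOGr : Representation ℂ G OGr where
  toFun g := (Ideal.quotientMapₐ idealGr (actO g) (actO_mem_idealGr g)).toLinearMap
  map_one' := by
    apply LinearMap.ext
    intro x
    obtain ⟨x, rfl⟩ := Ideal.Quotient.mk_surjective x
    simp
  map_mul' g h := by
    apply LinearMap.ext
    intro x
    obtain ⟨x, rfl⟩ := Ideal.Quotient.mk_surjective x
    change Ideal.Quotient.mk idealGr (actO (g * h) x) =
      Ideal.Quotient.mk idealGr (actO g (actO h x))
    rw [map_mul]
    rfl

/-! ### Equivariant modules -/

/-- A `G`-equivariant `O`-module: a representation of `G` on an `O`-module with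
`g (a m) = g(a) g(m)`. -/
def IsEquivariantModule {F : Type*} [AddCommGroup F] [Module ℂ F] [Module O F]
    (rho : Representation ℂ G F) : Prop :=
  ∀ (g : G) (a : O) (m : F), rho g (a • m) = rhoO g a • rho g m

/-- A `G`-equivariant homomorphism of `O`-modules. -/
def IsEquivariantMap {F F' : Type*} [AddCommGroup F] [Module ℂ F] [Module O F]
    [AddCommGroup F'] [Module ℂ F'] [Module O F']
    (rho : Representation ℂ G F) (rho' : Representation ℂ G F') (f : F →ₗ[O] F') : Prop :=
  ∀ (g : G) (m : F), f (rho g m) = rho' g (f m)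

/-- `O ⊗ V^∨ ⊗ D`. -/
abbrev F1 : Type := O ⊗[ℂ] (Module.Dual ℂ V ⊗[ℂ] D)

/-- `O ⊗ V ⊗ L ⊗ D`. -/
abbrev F2 : Type := O ⊗[ℂ] ((V ⊗[ℂ] L) ⊗[ℂ] D)

/-- `O ⊗ L ⊗ D²`. -/
abbrev F3 : Type := O ⊗[ℂ] (L ⊗[ℂ] (D ⊗[ℂ] D))

def rhoF1 : Representation ℂ G F1 := rhoO.tprod (rhoV.dual.tprod rhoD)

def rhoF2 : Representation ℂ G F2 := rhoO.tprod ((rhoV.tprod rhoL).tprod rhoD)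

def rhoF3 : Representation ℂ G F3 := rhoO.tprod (rhoL.tprod (rhoD.tprod rhoD))

/-! ### The universal skew form and its Pfaffian -/

/-- The universal skew form: the linear function `x(v, w)` on the affine space given by
`v ∧ w ⊗ 1`. -/
def x (v w : V) : O := SymmetricAlgebra.ι ℂ Lin (wedge v w ⊗ₜ[ℂ] (1 : L))

/-- The universal skew form as an alternating form with values in `O`. -/
def xForm : V [⋀^Fin 2]→ₗ[ℂ] O :=
  (SymmetricAlgebra.ι ℂ Lin ∘ₗ (TensorProduct.mk ℂ (Ext 2) L).flip 1).compAlternatingMap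
    (exteriorPower.ιMulti ℂ 2)

theorem xForm_apply (v w : V) : xForm ![v, w] = x v w := rfl

theorem update_pair (y v w : V) : Function.update ![v, w] 0 y = ![y, w] := by
  ext i
  fin_cases i <;> rfl

theorem x_add_left (u v w : V) : x (u + v) w = x u w + x v w := by
  have := xForm.map_update_add ![u, w] 0 u v
  simpa only [update_pair, xForm_apply] using this

theorem x_smul_left (c : ℂ) (v w : V) : x (c • v) w = c • x v w := by
  have := xForm.map_update_smul ![v, w] 0 c v
  simpa only [update_pair, xForm_apply] using this

theorem x_self (v : V) : x v v = 0 :=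
  xForm.map_eq_zero_of_eq ![v, v] (i := 0) (j := 1) rfl (by decide)

theorem x_swap (v w : V) : x v w = -x w v := by
  have := xForm.map_swap ![w, v] (i := 0) (j := 1) (by decide)
  rw [← xForm_apply, ← xForm_apply, ← this]
  congr 1
  ext i
  fin_cases i <;> rfl

theorem x_add_right (u v w : V) : x w (u + v) = x w u + x w v := by
  rw [x_swap, x_add_left, x_swap w u, x_swap w v]; ring

theorem x_smul_right (c : ℂ) (v w : V) : x w (c • v) = c • x w v := by
  rw [x_swap, x_smul_left, x_swap w v, smul_neg]

/-- The Pfaffian of the universal skew form, as an alternating four-form on `V`. -/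
def pfForm : V [⋀^Fin 4]→ₗ[ℂ] O where
  toFun v := x (v 0) (v 1) * x (v 2) (v 3) - x (v 0) (v 2) * x (v 1) (v 3)
    + x (v 0) (v 3) * x (v 1) (v 2)
  map_update_add' := by
    intro inst v i y z
    obtain rfl : inst = instDecidableEqFin 4 := Subsingleton.elim _ _
    fin_cases i <;> simp [Function.update, x_add_left, x_add_right] <;> ring
  map_update_smul' := by
    intro inst v i c y
    obtain rfl : inst = instDecidableEqFin 4 := Subsingleton.elim _ _
    fin_cases i <;>
      simp [Function.update, x_smul_left, x_smul_right, smul_sub, smul_add]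
  map_eq_zero_of_eq' := by
    intro v i j h hij
    have h01 := x_swap (v 1) (v 0)
    have h02 := x_swap (v 2) (v 0)
    have h03 := x_swap (v 3) (v 0)
    have h12 := x_swap (v 2) (v 1)
    have h13 := x_swap (v 3) (v 1)
    have h23 := x_swap (v 3) (v 2)
    have s0 := x_self (v 0)
    have s1 := x_self (v 1)
    have s2 := x_self (v 2)
    have s3 := x_self (v 3)
    fin_cases i <;> fin_cases j <;> simp only [Fin.zero_eta, Fin.mk_one, Fin.reduceFinMk, ne_eq,
      not_true_eq_false] at h hij ⊢ <;> rw [h] at * <;> grind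

/-- The Pfaffian as a map `⋀⁴V ⊗ L² → O`. -/
def pf4 : Ext 4 ⊗[ℂ] (L ⊗[ℂ] L) →ₗ[ℂ] O :=
  TensorProduct.lift
    ((LinearMap.lsmul ℂ O).flip ∘ₗ exteriorPower.alternatingMapLinearEquiv pfForm)
    ∘ₗ TensorProduct.map LinearMap.id (LinearMap.mul' ℂ ℂ)

/-- The contraction `V^∨ ⊗ ⋀⁵V → ⋀⁴V`,
`φ ⊗ (v₁ ∧ ⋯ ∧ v₅) ↦ ∑ i, (-1)^(i-1) φ(v_i) v₁ ∧ ⋯ v̂_i ⋯ ∧ v₅`. -/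
def contract : Module.Dual ℂ V ⊗[ℂ] Ext 5 →ₗ[ℂ] Ext 4 :=
  TensorProduct.lift
    (exteriorPower.alternatingMapLinearEquiv.toLinearMap
      ∘ₗ AlternatingMap.alternatizeUncurryFinLM
      ∘ₗ (LinearMap.smulRightₗ (R := ℂ) (M := V [⋀^Fin 4]→ₗ[ℂ] Ext 4) (M₂ := V)).flip
          (exteriorPower.ιMulti ℂ 4))

/-- The contraction `V^∨ ⊗ D → ⋀⁴V ⊗ L²`. -/
def contractD : Module.Dual ℂ V ⊗[ℂ] D →ₗ[ℂ] Ext 4 ⊗[ℂ] (L ⊗[ℂ] L) :=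
  TensorProduct.map contract LinearMap.id
    ∘ₗ (TensorProduct.assoc ℂ (Module.Dual ℂ V) (Ext 5) (L ⊗[ℂ] L)).symm.toLinearMap

/-- The Pfaffian as a map `V^∨ ⊗ D → O`. -/
def pfLin : Module.Dual ℂ V ⊗[ℂ] D →ₗ[ℂ] O := pf4 ∘ₗ contractD

/-- The standard basis of `V`. -/
def e (i : Fin 5) : V := Pi.single i 1

/-- The dual basis. -/
def eDual (i : Fin 5) : Module.Dual ℂ V := LinearMap.proj i

/-- The linear map `v ↦ x(w, v)`. -/
def xLin (w : V) : V →ₗ[ℂ] O where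
  toFun v := x w v
  map_add' u v := x_add_right u v w
  map_smul' c v := x_smul_right c v w

/-- The universal map `V ⊗ L → O ⊗ V^∨`, `v ⊗ l ↦ ∑ i, l x(e_i, v) ⊗ e_i^∨`, that is, `v ⊗ l`
goes to the linear form `w ↦ w ∧ v ⊗ l` on `V` with values in `O`. -/
def univLin : V ⊗[ℂ] L →ₗ[ℂ] O ⊗[ℂ] Module.Dual ℂ V :=
  ∑ i : Fin 5, (TensorProduct.mk ℂ O (Module.Dual ℂ V)).flip (eDual i)
    ∘ₗ xLin (e i) ∘ₗ (TensorProduct.rid ℂ V).toLinearMap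

/-- The map `Pf : O ⊗ V^∨ ⊗ D → O`. -/
def mapPf : F1 →ₗ[O] O := LinearMap.liftBaseChange O pfLin

/-- The map `M : O ⊗ V ⊗ L ⊗ D → O ⊗ V^∨ ⊗ D`. -/
def mapM : F2 →ₗ[O] F1 :=
  LinearMap.liftBaseChange O
    ((TensorProduct.assoc ℂ O (Module.Dual ℂ V) D).toLinearMap
      ∘ₗ TensorProduct.map univLin LinearMap.id)

/-- The transpose `ᵗPf : O ⊗ L ⊗ D² → O ⊗ V ⊗ L ⊗ D`,
`l ⊗ d ⊗ d' ↦ ∑ i, Pf(e_i^∨ ⊗ d) ⊗ e_i ⊗ l ⊗ d'`. -/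
def mapPfT : F3 →ₗ[O] F2 :=
  LinearMap.liftBaseChange O
    (∑ i : Fin 5,
      (TensorProduct.map
          (pfLin ∘ₗ TensorProduct.mk ℂ (Module.Dual ℂ V) D (eDual i))
          (TensorProduct.map (TensorProduct.mk ℂ V L (e i)) LinearMap.id)
        ∘ₗ (TensorProduct.leftComm ℂ L D D).toLinearMap))

/-- The augmentation `O → O_aGr`. -/
def mapAug : O →ₗ[O] OGr := idealGr.mkQ

/-! ### Coordinates -/

/-- The generic skew matrix `(x_ij)`. -/
def genericSkew : Matrix (Fin 5) (Fin 5) O := fun i j => x (e i) (e j)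

/-- The `i`-th signed `4 × 4` Pfaffian of the generic skew matrix, omitting the `i`-th row
and column. -/
def pfaffian (i : Fin 5) : O :=
  let m : Fin 4 → Fin 4 → O := fun a b => genericSkew (i.succAbove a) (i.succAbove b)
  (-1) ^ (i : ℕ) * (m 0 1 * m 2 3 - m 0 2 * m 1 3 + m 0 3 * m 1 2)

/-- The generator of `D` given by the standard basis. -/
def volD : D := exteriorPower.ιMulti ℂ 5 e ⊗ₜ[ℂ] ((1 : L) ⊗ₜ[ℂ] (1 : L))

end AffGr

end

open AffGr

/-! Exactness is proved on a linear section and then lifted. Write p₀, …, p₄ for the entries of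
`pfVec (skew y)`. In the coordinates of `skew`, setting the last seven variables to zero turns p₄,
p₁, p₀ into X₀², -X₂², X₁² + X₀X₂, a regular sequence. Over any commutative ring, such regularity
gives exactness at both inner terms (`exists_eq_skew_mulVec_of_regular`,
`exists_eq_smul_pfVec_of_regular`). Two identities carry this, both from Pfaffian adjoints of 4 × 4
diagonal blocks: p₄ annihilates the homology at the syzygies, and a kernel vector of the matrix
modulo q is proportional to the Pfaffian vector modulo q. The seven variables are then restored one
at a time by a graded Nakayama argument (`ExactPair.of_killVar`).

For the ideal of the cone, exactness with only `X 6` = x₁₂ set to zero makes x₁₂ a nonzerodivisor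
modulo the Pfaffians (`mem_pfIdeal_of_X_mul_mem`). The wedge of the first two rows of the generic
matrix lies on the cone at every point, and modulo the Pfaffians it equals x₁₂ times the generic
form. So if f is homogeneous of degree n and vanishes on the cone, x₁₂ⁿ f lies in the Pfaffian
ideal, and hence so does f.

Equivariance of M and ᵗPf comes from the invariance of ∑ eᵢ^∨ ⊗ eᵢ (`sum_bilin_rhoV`); that of Pf
from the naturality of the contraction and of the Pfaffian form. -/

noncomputable section

namespace AffGr

/-! ### Signed Pfaffians of a `5 × 5` alternating matrix -/

/-- The vector of signed `4 × 4` Pfaffians of a `5 × 5` matrix. -/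
def pfVec {T : Type*} [CommRing T] (m : Matrix (Fin 5) (Fin 5) T) (i : Fin 5) : T :=
  (-1) ^ (i : ℕ) * (m (i.succAbove 0) (i.succAbove 1) * m (i.succAbove 2) (i.succAbove 3)
    - m (i.succAbove 0) (i.succAbove 2) * m (i.succAbove 1) (i.succAbove 3)
    + m (i.succAbove 0) (i.succAbove 3) * m (i.succAbove 1) (i.succAbove 2))

theorem pfaffian_eq_pfVec : pfaffian = pfVec genericSkew := rfl

/-- The alternating matrix with independent entries, in coordinates in which the vanishing of
the last seven leaves an Artinian section of the Pfaffian ideal. -/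
def skew {T : Type*} [CommRing T] (y : Fin 10 → T) : Matrix (Fin 5) (Fin 5) T :=
  !![0, y 6, y 3 - y 0, y 2, y 9;
    -y 6, 0, y 7, y 0, y 1;
    -(y 3 - y 0), -y 7, 0, y 4 + y 1, y 5 - y 2;
    -y 2, -y 0, -(y 4 + y 1), 0, y 8;
    -y 9, -y 1, -(y 5 - y 2), -y 8, 0]

/-- The coordinates of an alternating family. -/
def coordOf {T : Type*} [AddCommGroup T] (d : Fin 5 → Fin 5 → T) : Fin 10 → T :=
  ![d 1 3, d 1 4, d 0 3, d 0 2 + d 1 3, d 2 3 - d 1 4, d 2 4 + d 0 3, d 0 1, d 1 2, d 3 4, d 0 4]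

theorem map_coordOf {T S F : Type*} [AddCommGroup T] [AddCommGroup S] [FunLike F T S]
    [AddMonoidHomClass F T S] (φ : F) (d : Fin 5 → Fin 5 → T) (k : Fin 10) :
    φ (coordOf d k) = coordOf (fun i j => φ (d i j)) k := by
  fin_cases k <;> simp [coordOf]

theorem skew_coordOf {T : Type*} [CommRing T] {d : Fin 5 → Fin 5 → T} (h0 : ∀ i, d i i = 0)
    (h : ∀ i j, d i j = -d j i) (i j : Fin 5) : skew (coordOf d) i j = d i j := by
  rcases lt_trichotomy i j with hij | rfl | hij
  · fin_cases i <;> fin_cases j <;> simp [skew, coordOf] at hij ⊢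
  · fin_cases i <;> simp [skew, h0]
  · rw [h]
    fin_cases i <;> fin_cases j <;> simp [skew, coordOf] at hij ⊢

section Ring

variable {T : Type*} [CommRing T]

theorem pfVec_skew (y : Fin 10 → T) : pfVec (skew y) =
    ![y 7 * y 8 - y 0 * (y 5 - y 2) + y 1 * (y 4 + y 1),
      -((y 3 - y 0) * y 8 - y 2 * (y 5 - y 2) + y 9 * (y 4 + y 1)),
      y 6 * y 8 - y 2 * y 1 + y 9 * y 0,
      -(y 6 * (y 5 - y 2) - (y 3 - y 0) * y 1 + y 9 * y 7),
      y 6 * (y 4 + y 1) - (y 3 - y 0) * y 0 + y 2 * y 7] := by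
  ext i
  fin_cases i <;> simp [pfVec, skew, Fin.succAbove, Fin.lt_def, pow_succ]

theorem skew_mulVec (y : Fin 10 → T) (b : Fin 5 → T) : (skew y).mulVec b =
    ![y 6 * b 1 + (y 3 - y 0) * b 2 + y 2 * b 3 + y 9 * b 4,
      -y 6 * b 0 + y 7 * b 2 + y 0 * b 3 + y 1 * b 4,
      -(y 3 - y 0) * b 0 - y 7 * b 1 + (y 4 + y 1) * b 3 + (y 5 - y 2) * b 4,
      -y 2 * b 0 - y 0 * b 1 - (y 4 + y 1) * b 2 + y 8 * b 4,
      -y 9 * b 0 - y 1 * b 1 - (y 5 - y 2) * b 2 - y 8 * b 3] := by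
  ext i
  fin_cases i <;> simp [Matrix.mulVec, dotProduct, skew, Fin.sum_univ_five] <;> ring

theorem skew_map {S F : Type*} [CommRing S] [FunLike F T S] [RingHomClass F T S] (φ : F)
    (y : Fin 10 → T) (i j : Fin 5) : φ (skew y i j) = skew (fun k => φ (y k)) i j := by
  fin_cases i <;> fin_cases j <;> simp [skew]

theorem pfVec_map {S F : Type*} [CommRing S] [FunLike F T S] [RingHomClass F T S] (φ : F)
    (m : Matrix (Fin 5) (Fin 5) T) (i : Fin 5) : φ (pfVec m i) = pfVec (m.map φ) i := by
  simp [pfVec]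

theorem pfVec_dotProduct_skew (y : Fin 10 → T) (b : Fin 5 → T) :
    pfVec (skew y) ⬝ᵥ (skew y).mulVec b = 0 := by
  simp [skew_mulVec, pfVec_skew, dotProduct, Fin.sum_univ_five]
  ring

theorem skew_mulVec_pfVec (y : Fin 10 → T) : (skew y).mulVec (pfVec (skew y)) = 0 := by
  rw [skew_mulVec]
  ext i
  fin_cases i <;> simp [pfVec_skew] <;> ring

/-- The last Pfaffian annihilates the homology at the middle term of the complex. -/
theorem exists_smul_eq_skew_mulVec (y : Fin 10 → T) (c : Fin 5 → T)
    (hc : pfVec (skew y) ⬝ᵥ c = 0) : ∃ b, pfVec (skew y) 4 • c = (skew y).mulVec b := by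
  -- The first four entries are the Pfaffian adjoint of the block on rows 0–3 applied to `c`. That
  -- adjoint inverts the block up to p₄, so rows 0–3 are identities; only row 4 needs `hc`.
  refine ⟨![-(y 4 + y 1) * c 1 + y 0 * c 2 - y 7 * c 3,
    (y 4 + y 1) * c 0 - y 2 * c 2 + (y 3 - y 0) * c 3,
    -y 0 * c 0 + y 2 * c 1 - y 6 * c 3,
    y 7 * c 0 - (y 3 - y 0) * c 1 + y 6 * c 2, 0], ?_⟩
  rw [skew_mulVec]
  simp only [pfVec_skew, dotProduct, Fin.sum_univ_five] at hc ⊢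
  ext i
  fin_cases i <;> simp at hc ⊢ <;> first | ring1 | linear_combination hc

/-- A kernel vector of the matrix modulo `q` is proportional to the Pfaffian vector modulo `q`. -/
theorem pfVec_mul_comm_of_skew_mulVec (y : Fin 10 → T) (b : Fin 5 → T) (q : T)
    (hb : ∀ i, q ∣ (skew y).mulVec b i) (j : Fin 5) :
    q ∣ pfVec (skew y) 1 * b j - pfVec (skew y) j * b 1 := by
  have h0 := hb 0
  have h2 := hb 2
  have h3 := hb 3
  have h4 := hb 4
  simp only [skew_mulVec, pfVec_skew] at h0 h2 h3 h4 ⊢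
  obtain ⟨r0, h0⟩ := h0
  obtain ⟨r2, h2⟩ := h2
  obtain ⟨r3, h3⟩ := h3
  obtain ⟨r4, h4⟩ := h4
  simp at h0 h2 h3 h4
  -- Rows 0, 2, 3, 4 express the block omitting index 1, applied to the other entries of `b`, as -b₁
  -- times column 1 modulo q. The coefficients below are the rows of the Pfaffian adjoint of that
  -- block.
  fin_cases j <;> simp
  · refine ⟨y 8 * r2 - (y 5 - y 2) * r3 + (y 4 + y 1) * r4, ?_⟩
    linear_combination y 8 * h2 - (y 5 - y 2) * h3 + (y 4 + y 1) * h4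
  · refine ⟨-y 8 * r0 + y 9 * r3 - y 2 * r4, ?_⟩
    linear_combination -y 8 * h0 + y 9 * h3 - y 2 * h4
  · refine ⟨(y 5 - y 2) * r0 - y 9 * r2 + (y 3 - y 0) * r4, ?_⟩
    linear_combination (y 5 - y 2) * h0 - y 9 * h2 + (y 3 - y 0) * h4
  · refine ⟨-(y 4 + y 1) * r0 + y 2 * r2 - (y 3 - y 0) * r3, ?_⟩
    linear_combination -(y 4 + y 1) * h0 + y 2 * h2 - (y 3 - y 0) * h3

/-- Three Pfaffians forming a regular sequence make the Pfaffian complex exact at the kernel of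
the matrix. -/
theorem exists_eq_smul_pfVec_of_regular (y : Fin 10 → T)
    (h5 : ∀ f, pfVec (skew y) 4 * f = 0 → f = 0)
    (h2' : ∀ f, pfVec (skew y) 1 * f = 0 → f = 0)
    (h2 : ∀ f, pfVec (skew y) 4 ∣ pfVec (skew y) 1 * f → pfVec (skew y) 4 ∣ f)
    (b : Fin 5 → T) (hb : (skew y).mulVec b = 0) : ∃ t : T, b = t • pfVec (skew y) := by
  have key j : pfVec (skew y) 1 * b j = pfVec (skew y) j * b 1 := by
    have := pfVec_mul_comm_of_skew_mulVec y b 0 (fun i => by rw [hb]; simp) j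
    rwa [zero_dvd_iff, sub_eq_zero] at this
  -- The factor t is read off from entry 4, where p₁b₄ = p₄b₁ forces p₄ ∣ b₄; cancelling p₄ and then
  -- p₁ spreads it to all entries.
  obtain ⟨t, ht⟩ := h2 (b 4) ⟨_, key 4⟩
  have h1 : b 1 = t * pfVec (skew y) 1 := by
    have := key 4
    rw [ht] at this
    rw [← sub_eq_zero]
    apply h5
    linear_combination -this
  refine ⟨t, funext fun j => ?_⟩
  rw [← sub_eq_zero]
  apply h2'
  have := key j
  rw [h1] at this
  simp only [Pi.smul_apply, smul_eq_mul]
  linear_combination this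

/-- Three Pfaffians forming a regular sequence make the Pfaffian complex exact at the syzygies of
the Pfaffians. -/
theorem exists_eq_skew_mulVec_of_regular (y : Fin 10 → T)
    (h5 : ∀ f, pfVec (skew y) 4 * f = 0 → f = 0)
    (h2 : ∀ f, pfVec (skew y) 4 ∣ pfVec (skew y) 1 * f → pfVec (skew y) 4 ∣ f)
    (h1 : ∀ f r s, pfVec (skew y) 0 * f = pfVec (skew y) 4 * r + pfVec (skew y) 1 * s →
      ∃ r s, f = pfVec (skew y) 4 * r + pfVec (skew y) 1 * s)
    (c : Fin 5 → T) (hc : pfVec (skew y) ⬝ᵥ c = 0) : ∃ b, c = (skew y).mulVec b := by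
  obtain ⟨b, hb⟩ := exists_smul_eq_skew_mulVec y c hc
  have key := pfVec_mul_comm_of_skew_mulVec y b (pfVec (skew y) 4)
    (fun i => ⟨c i, by rw [← hb]; simp⟩)
  obtain ⟨r, hr⟩ := key 0
  -- Since p₄c = Ab, the vector b is in the kernel modulo p₄, so p₀b₁ lies in (p₄, p₁), and
  -- regularity puts b₁ there too. Then b ≡ t·(Pfaffian vector) modulo p₄; the matrix kills that
  -- vector, and p₄ cancels from p₄c = p₄Ad.
  obtain ⟨r', t, ht⟩ := h1 (b 1) (-r) (b 0) (by linear_combination -hr)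
  have hj (j) : pfVec (skew y) 4 ∣ b j - t * pfVec (skew y) j := by
    apply h2
    obtain ⟨s, hs⟩ := key j
    refine ⟨s + pfVec (skew y) j * r', ?_⟩
    rw [ht] at hs
    linear_combination hs
  choose d hd using hj
  have hbd : b = t • pfVec (skew y) + pfVec (skew y) 4 • d := by
    ext j
    simp only [Pi.add_apply, Pi.smul_apply, smul_eq_mul]
    linear_combination hd j
  refine ⟨d, funext fun j => ?_⟩
  rw [hbd, Matrix.mulVec_add, Matrix.mulVec_smul, Matrix.mulVec_smul, skew_mulVec_pfVec,
    smul_zero, zero_add] at hb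
  rw [← sub_eq_zero]
  apply h5
  have := congrFun hb j
  simp only [Pi.smul_apply, smul_eq_mul] at this
  linear_combination this

end Ring

/-! ### Graded Nakayama: lifting exactness from a coordinate hyperplane -/

section Specialization

open MvPolynomial

variable {K σ : Type*} [Field K]

/-- The part of `f` which multiplication by a form of degree `d` sends to degree `n`. -/
def shiftedComponent (d n : ℕ) (f : MvPolynomial σ K) : MvPolynomial σ K :=
  -- Natural subtraction truncates, so without the guard degrees n < d would wrongly return the
  -- constant term.
  if d ≤ n then homogeneousComponent (n - d) f else 0

theorem homogeneousComponent_mul {q : MvPolynomial σ K} {d : ℕ} (hq : q.IsHomogeneous d)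
    (f : MvPolynomial σ K) (n : ℕ) :
    homogeneousComponent n (q * f) = q * shiftedComponent d n f := by
  have hm (m : ℕ) : homogeneousComponent n (q * homogeneousComponent m f) =
      if m + d = n then q * homogeneousComponent m f else 0 := by
    rw [homogeneousComponent_of_mem
      ((mem_homogeneousSubmodule _ _).2 (hq.mul (homogeneousComponent_isHomogeneous m f)))]
    simp only [add_comm d m, eq_comm]
  conv_lhs => rw [← sum_homogeneousComponent f, Finset.mul_sum, map_sum]
  simp only [hm]
  unfold shiftedComponent
  split_ifs with h
  · rw [Finset.sum_eq_single (n - d)]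
    · rw [if_pos (by omega)]
    · intro m _ hmn
      rw [if_neg (by omega)]
    · intro hmem
      rw [if_pos (by omega), homogeneousComponent_eq_zero _ _ (by simp at hmem; omega), mul_zero]
  · rw [mul_zero]
    exact Finset.sum_eq_zero fun m _ => if_neg (by omega)

theorem homogeneousComponent_mul_left {q : MvPolynomial σ K} {d : ℕ} (hq : q.IsHomogeneous d)
    (f : MvPolynomial σ K) (n : ℕ) :
    homogeneousComponent (d + n) (q * f) = q * homogeneousComponent n f := by
  rw [homogeneousComponent_mul hq, shiftedComponent, if_pos (by omega), Nat.add_sub_cancel_left]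

theorem homogeneousComponent_mul_left_of_lt {q : MvPolynomial σ K} {d : ℕ}
    (hq : q.IsHomogeneous d) (f : MvPolynomial σ K) {n : ℕ} (hn : n < d) :
    homogeneousComponent n (q * f) = 0 := by
  rw [homogeneousComponent_mul hq, shiftedComponent, if_neg (by omega), mul_zero]

theorem homogeneousComponent_mulVec {ι κ : Type*} [Fintype κ]
    (A : Matrix ι κ (MvPolynomial σ K)) {d : ℕ} (hA : ∀ i j, (A i j).IsHomogeneous d)
    (b : κ → MvPolynomial σ K) (n : ℕ) (i : ι) :
    homogeneousComponent n (A.mulVec b i) = A.mulVec (fun j => shiftedComponent d n (b j)) i := by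
  simp only [Matrix.mulVec, dotProduct, map_sum]
  exact Finset.sum_congr rfl fun j _ => homogeneousComponent_mul (hA i j) _ _

variable [DecidableEq σ]

/-- The specialization of a variable to zero. -/
def killVar (a : σ) : MvPolynomial σ K →ₐ[K] MvPolynomial σ K :=
  aeval (Function.update X a 0)

/-- `killVar a` represents reduction modulo `X a` inside the same polynomial ring, so congruences
become equalities of polynomials. -/
theorem X_dvd_sub_killVar (a : σ) (f : MvPolynomial σ K) : X a ∣ f - killVar a f := by
  induction f using MvPolynomial.induction_on with
  | C r => simp [killVar]
  | add p q hp hq =>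
    rw [map_add, add_sub_add_comm]
    exact dvd_add hp hq
  | mul_X p i hp =>
    by_cases h : i = a
    · subst h
      simp [killVar]
    · have : killVar a (X i : MvPolynomial σ K) = X i := by
        simp [killVar, Function.update_of_ne h]
      rw [map_mul, this, ← sub_mul]
      exact Dvd.dvd.mul_right hp _

theorem killVar_X_self (a : σ) : killVar a (X a : MvPolynomial σ K) = 0 := by
  simp [killVar]

theorem killVar_X_of_ne {a i : σ} (h : i ≠ a) :
    killVar a (X i : MvPolynomial σ K) = X i := by
  simp [killVar, Function.update_of_ne h]

/-- Exactness at the middle of `R^κ → R^ι → R^μ`. -/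
def ExactPair {ι κ μ R : Type*} [CommRing R] [Fintype ι] [Fintype κ]
    (A : Matrix ι κ R) (B : Matrix μ ι R) : Prop :=
  ∀ c, B.mulVec c = 0 → ∃ b, c = A.mulVec b

variable {ι κ μ : Type*} [Fintype ι] [Fintype κ]

/-- A cycle modulo `X a` specializes to a cycle, which is a boundary of the specialized complex;
lifting that boundary leaves an error divisible by `X a`. -/
theorem exists_eq_mulVec_add_X_smul {A : Matrix ι κ (MvPolynomial σ K)}
    {B : Matrix μ ι (MvPolynomial σ K)} (a : σ)
    (h : ExactPair (A.map (killVar a)) (B.map (killVar a))) (c : ι → MvPolynomial σ K)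
    (hc : ∀ i, X a ∣ B.mulVec c i) :
    ∃ b, ∃ c' : ι → MvPolynomial σ K, ∀ i, c i = A.mulVec b i + X a * c' i := by
  obtain ⟨b, hb⟩ := h (fun i => killVar a (c i)) <| by
    ext1 i
    obtain ⟨r, hr⟩ := hc i
    have := congrArg (killVar a) hr
    rw [map_mul, killVar_X_self, zero_mul] at this
    rw [Pi.zero_apply, ← this]
    simp [Matrix.mulVec, dotProduct]
  have hdvd (i) : X a ∣ c i - A.mulVec b i := by
    have h1 := X_dvd_sub_killVar a (c i)
    have h2 : X a ∣ A.mulVec b i - (A.map (killVar a)).mulVec b i := by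
      simp only [Matrix.mulVec, dotProduct, ← Finset.sum_sub_distrib, ← sub_mul, Matrix.map_apply]
      exact Finset.dvd_sum fun j _ => Dvd.dvd.mul_right (X_dvd_sub_killVar a _) _
    have h3 := dvd_sub h1 h2
    rw [← congrFun hb i] at h3
    convert h3 using 1
    ring
  choose c' hc' using hdvd
  exact ⟨b, c', fun i => by linear_combination hc' i⟩

/-- A complex of graded free modules which becomes exact on a hyperplane section is exact. -/
theorem ExactPair.of_killVar {A : Matrix ι κ (MvPolynomial σ K)}
    {B : Matrix μ ι (MvPolynomial σ K)} {d d' : ℕ} (hA : ∀ i j, (A i j).IsHomogeneous d)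
    (hB : ∀ i j, (B i j).IsHomogeneous d') (hBA : ∀ b, B.mulVec (A.mulVec b) = 0) (a : σ)
    (h : ExactPair (A.map (killVar a)) (B.map (killVar a))) : ExactPair A B := by
  -- Induction on the degree: modulo the image of A, a homogeneous cycle is `X a` times a cycle of
  -- degree one less. In degree 0 the correction term has no component.
  have main (n : ℕ) : ∀ c : ι → MvPolynomial σ K, (∀ i, (c i).IsHomogeneous n) →
      B.mulVec c = 0 → ∃ b, c = A.mulVec b := by
    induction n with
    | zero =>
      intro c hc hBc
      obtain ⟨b, c', h'⟩ := exists_eq_mulVec_add_X_smul a h c fun i => by rw [hBc]; simp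
      refine ⟨fun j => shiftedComponent d 0 (b j), funext fun i => ?_⟩
      have := congrArg (homogeneousComponent 0) (h' i)
      rwa [homogeneousComponent_eq_self (hc i), map_add, homogeneousComponent_mulVec A hA,
        homogeneousComponent_mul_left_of_lt (isHomogeneous_X K a) _ one_pos, add_zero] at this
    | succ n ih =>
      intro c hc hBc
      obtain ⟨b, c', h'⟩ := exists_eq_mulVec_add_X_smul a h c fun i => by rw [hBc]; simp
      set b₁ := fun j => shiftedComponent d (n + 1) (b j) with hb₁
      set c₁ := fun i => homogeneousComponent n (c' i) with hc₁
      have h₁ : c = A.mulVec b₁ + (X a : MvPolynomial σ K) • c₁ := by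
        ext1 i
        have := congrArg (homogeneousComponent (n + 1)) (h' i)
        rwa [homogeneousComponent_eq_self (hc i), map_add, homogeneousComponent_mulVec A hA,
          add_comm n 1, homogeneousComponent_mul_left (isHomogeneous_X K a), add_comm 1 n] at this
      have h₂ : B.mulVec c₁ = 0 := by
        rw [h₁, Matrix.mulVec_add, hBA, zero_add, Matrix.mulVec_smul] at hBc
        -- `X a` is a nonzerodivisor, so the quotient c₁ is again a cycle.
        exact (smul_eq_zero.mp hBc).resolve_left (X_ne_zero a)
      obtain ⟨b₂, hb₂⟩ := ih c₁ (fun i => homogeneousComponent_isHomogeneous _ _) h₂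
      exact ⟨b₁ + (X a : MvPolynomial σ K) • b₂, by
        rw [h₁, hb₂, Matrix.mulVec_add, Matrix.mulVec_smul]⟩
  intro c hc
  -- As B is homogeneous, each graded component of a cycle is a cycle; N bounds the degrees needed
  -- to reassemble c.
  have hcomp (n : ℕ) : ∃ b, (fun i => homogeneousComponent n (c i)) = A.mulVec b := by
    refine main n _ (fun i => homogeneousComponent_isHomogeneous _ _) (funext fun i => ?_)
    have := homogeneousComponent_mulVec B hB c (d' + n) i
    rw [hc, Pi.zero_apply, map_zero] at this
    simpa [shiftedComponent] using this.symm
  choose b hb using hcomp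
  set N := Finset.univ.sup fun i => (c i).totalDegree
  refine ⟨∑ n ∈ Finset.range (N + 1), b n, ?_⟩
  rw [Matrix.mulVec_sum]
  simp only [← hb]
  ext1 i
  rw [Finset.sum_apply]
  have hi : (c i).totalDegree ≤ N := Finset.le_sup (f := fun i => (c i).totalDegree)
    (Finset.mem_univ i)
  conv_lhs => rw [← sum_homogeneousComponent (c i)]
  refine Finset.sum_subset (Finset.range_mono (by omega)) fun n _ hn => ?_
  exact homogeneousComponent_eq_zero _ _ (by simpa using hn)

end Specialization

/-! ### Exactness of the Pfaffian complex over the polynomial ring -/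

section Resolution

open MvPolynomial

/-- The coordinates with those in `s` replaced by zero. -/
def spec (s : Finset (Fin 10)) (i : Fin 10) : MvPolynomial (Fin 10) ℂ :=
  if i ∈ s then 0 else X i

theorem spec_empty : spec ∅ = X := by
  ext1 i
  simp [spec]

theorem spec_isHomogeneous (s : Finset (Fin 10)) (i : Fin 10) : (spec s i).IsHomogeneous 1 := by
  unfold spec
  split_ifs
  · exact isHomogeneous_zero _ _ _
  · exact isHomogeneous_X _ _

theorem killVar_spec (a : Fin 10) (s : Finset (Fin 10)) :
    (fun i => killVar a (spec s i)) = spec (insert a s) := by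
  ext1 i
  by_cases ha : i = a
  · subst ha
    by_cases hs : i ∈ s <;> simp [spec, hs, killVar_X_self]
  · by_cases hs : i ∈ s <;> simp [spec, hs, ha, killVar_X_of_ne]

theorem skew_mem {T : Type*} [CommRing T] (S : AddSubgroup T) {y : Fin 10 → T}
    (hy : ∀ i, y i ∈ S) (i j : Fin 5) : skew y i j ∈ S := by
  have hsub (i j) : y i - y j ∈ S := S.sub_mem (hy i) (hy j)
  have hadd (i j) : y i + y j ∈ S := S.add_mem (hy i) (hy j)
  have hneg (i j) : -y i + -y j ∈ S := S.add_mem (S.neg_mem (hy i)) (S.neg_mem (hy j))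
  fin_cases i <;> fin_cases j <;> simp [skew, hy, hsub, hadd, hneg, S.zero_mem]

theorem skew_isHomogeneous {y : Fin 10 → MvPolynomial (Fin 10) ℂ} {d : ℕ}
    (hy : ∀ i, (y i).IsHomogeneous d) (i j : Fin 5) : (skew y i j).IsHomogeneous d :=
  skew_mem (homogeneousSubmodule (Fin 10) ℂ d).toAddSubgroup hy i j

theorem pfVec_isHomogeneous {m : Matrix (Fin 5) (Fin 5) (MvPolynomial (Fin 10) ℂ)} {d : ℕ}
    (hm : ∀ i j, (m i j).IsHomogeneous d) (i : Fin 5) : (pfVec m i).IsHomogeneous (d + d) := by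
  have hs : (((-1) ^ (i : ℕ) : MvPolynomial (Fin 10) ℂ)).IsHomogeneous 0 := by
    simpa using (isHomogeneous_one (Fin 10) ℂ).neg.pow i
  have := hs.mul ((((hm (i.succAbove 0) (i.succAbove 1)).mul
    (hm (i.succAbove 2) (i.succAbove 3))).sub ((hm (i.succAbove 0) (i.succAbove 2)).mul
    (hm (i.succAbove 1) (i.succAbove 3)))).add ((hm (i.succAbove 0) (i.succAbove 3)).mul
    (hm (i.succAbove 1) (i.succAbove 2))))
  rwa [zero_add] at this

/-- Exactness of the Pfaffian complex of an alternating matrix at its two inner terms. -/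
def PfaffianExact {T : Type*} [CommRing T] (y : Fin 10 → T) : Prop :=
  ExactPair (skew y) (Matrix.of fun _ : Unit => pfVec (skew y)) ∧
    ExactPair (Matrix.of fun i (_ : Unit) => pfVec (skew y) i) (skew y)

theorem PfaffianExact.exists_eq_skew_mulVec {T : Type*} [CommRing T] {y : Fin 10 → T}
    (h : PfaffianExact y) (c : Fin 5 → T) (hc : pfVec (skew y) ⬝ᵥ c = 0) :
    ∃ b, c = (skew y).mulVec b :=
  h.1 c (funext fun _ => hc)

theorem PfaffianExact.exists_eq_smul {T : Type*} [CommRing T] {y : Fin 10 → T}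
    (h : PfaffianExact y) (b : Fin 5 → T) (hb : (skew y).mulVec b = 0) :
    ∃ t : T, b = t • pfVec (skew y) := by
  obtain ⟨t, ht⟩ := h.2 b hb
  refine ⟨t (), ?_⟩
  rw [ht]
  ext1 i
  simp [Matrix.mulVec, dotProduct, mul_comm]

/-- Setting one more variable to zero is a hyperplane section of the complex, whose matrices are
homogeneous of degrees 1 and 2, so `ExactPair.of_killVar` applies at both inner terms. -/
theorem PfaffianExact.of_insert {a : Fin 10} {s : Finset (Fin 10)}
    (h : PfaffianExact (spec (insert a s))) : PfaffianExact (spec s) := by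
  have h1 : (skew (spec s)).map (killVar a) = skew (spec (insert a s)) := by
    ext1 i j
    rw [Matrix.map_apply, skew_map, killVar_spec]
  have h2 (i) : killVar a (pfVec (skew (spec s)) i) = pfVec (skew (spec (insert a s))) i := by
    rw [pfVec_map, h1]
  have hs := skew_isHomogeneous (spec_isHomogeneous s)
  constructor
  · refine ExactPair.of_killVar hs (d' := 1 + 1) (fun _ i => pfVec_isHomogeneous hs i)
      (fun b => funext fun _ => pfVec_dotProduct_skew _ b) a ?_
    convert h.1 using 1
    ext1 _ i
    exact h2 i
  · refine ExactPair.of_killVar (d := 1 + 1) (fun i _ => pfVec_isHomogeneous hs i) hs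
      (fun b => ?_) a ?_
    · have : (Matrix.of fun i (_ : Unit) => pfVec (skew (spec s)) i).mulVec b =
          b () • pfVec (skew (spec s)) := by
        ext1 i
        simp [Matrix.mulVec, dotProduct, mul_comm]
      rw [this, Matrix.mulVec_smul, skew_mulVec_pfVec, smul_zero]
    · convert h.2 using 1
      ext1 i _
      exact h2 i

theorem PfaffianExact.of_union {s : Finset (Fin 10)} (t : Finset (Fin 10))
    (h : PfaffianExact (spec (t ∪ s))) : PfaffianExact (spec s) := by
  induction t using Finset.induction_on with
  | empty => simpa using h
  | insert a t _ ih =>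
    rw [Finset.insert_union] at h
    exact ih h.of_insert

/-- `X a` is a nonzerodivisor modulo (X_u², X_v²): subtracting the relation specialized at `X a` = 0
makes both coefficients divisible by `X a`. -/
theorem exists_of_X_mul_eq {σ : Type*} [DecidableEq σ] {a u v : σ} (hu : u ≠ a) (hv : v ≠ a)
    (f : MvPolynomial σ ℂ) (h : ∃ r s, X a * f = X u ^ 2 * r + X v ^ 2 * s) :
    ∃ r s, f = X u ^ 2 * r + X v ^ 2 * s := by
  obtain ⟨r, s, h⟩ := h
  obtain ⟨r', hr⟩ := X_dvd_sub_killVar a r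
  obtain ⟨s', hs⟩ := X_dvd_sub_killVar a s
  refine ⟨r', s', mul_left_cancel₀ (X_ne_zero a) ?_⟩
  have h0 := congrArg (killVar a) h
  simp only [map_mul, map_add, map_pow, killVar_X_self, killVar_X_of_ne hu,
    killVar_X_of_ne hv] at h0
  linear_combination h - h0 + X u ^ 2 * hr + X v ^ 2 * hs

theorem X_sq_dvd_of_dvd_mul {σ : Type*} {u v : σ} (huv : u ≠ v) (f : MvPolynomial σ ℂ)
    (h : X u ^ 2 ∣ X v ^ 2 * f) : X u ^ 2 ∣ f := by
  refine (X_prime (i := u)).pow_dvd_of_dvd_mul_left 2 (fun hd => ?_) h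
  have := X_prime.dvd_of_dvd_pow hd
  rw [X_dvd_X] at this
  exact huv this

/-- The Pfaffian complex is exact on an Artinian section. -/
theorem pfaffianExact_artinian : PfaffianExact (spec {3, 4, 5, 6, 7, 8, 9}) := by
  have p4 : pfVec (skew (spec {3, 4, 5, 6, 7, 8, 9})) 4 = X 0 ^ 2 := by
    simp [pfVec_skew, spec]
    ring
  have p1 : pfVec (skew (spec {3, 4, 5, 6, 7, 8, 9})) 1 = -X 2 ^ 2 := by
    simp [pfVec_skew, spec]
    ring
  have p0 : pfVec (skew (spec {3, 4, 5, 6, 7, 8, 9})) 0 = X 1 ^ 2 + X 0 * X 2 := by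
    simp [pfVec_skew, spec]
    ring
  have h4 (f : MvPolynomial (Fin 10) ℂ) (hf : (X 0 : MvPolynomial (Fin 10) ℂ) ^ 2 * f = 0) :
      f = 0 := by
    simpa using hf
  have h1 (f : MvPolynomial (Fin 10) ℂ) (hf : (X 0 : MvPolynomial (Fin 10) ℂ) ^ 2 ∣
      -X 2 ^ 2 * f) : X 0 ^ 2 ∣ f := by
    rw [neg_mul, dvd_neg] at hf
    exact X_sq_dvd_of_dvd_mul (by decide) f hf
  have h0 (f r s : MvPolynomial (Fin 10) ℂ)
      (h : (X 1 ^ 2 + X 0 * X 2) * f = X 0 ^ 2 * r + -X 2 ^ 2 * s) :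
      ∃ r s, f = X 0 ^ 2 * r + -X 2 ^ 2 * s := by
    have : ∃ r s, f = X 0 ^ 2 * r + X 2 ^ 2 * s := by
      -- Multiplying by X₁² - X₀X₂ turns the factor of f into X₁⁴ - X₀²X₂², so X₁⁴f lies in (X₀²,
      -- X₂²); X₁ is then cancelled four times.
      iterate 4 refine exists_of_X_mul_eq (a := 1) (by decide) (by decide) _ ?_
      exact ⟨(X 1 ^ 2 - X 0 * X 2) * r + X 2 ^ 2 * f, -(X 1 ^ 2 - X 0 * X 2) * s, by
        linear_combination (X 1 ^ 2 - X 0 * X 2) * h⟩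
    obtain ⟨r, s, h⟩ := this
    exact ⟨r, -s, by rw [h]; ring⟩
  constructor
  · intro c hc
    refine exists_eq_skew_mulVec_of_regular _ ?_ ?_ ?_ c (congrFun hc ()) <;>
      simpa only [p4, p1, p0]
  · intro b hb
    obtain ⟨t, ht⟩ := exists_eq_smul_pfVec_of_regular _ (by simpa only [p4])
      (by rw [p1]; intro f hf; simpa using hf) (by simpa only [p4, p1]) b hb
    exact ⟨fun _ => t, by rw [ht]; ext1 i; simp [Matrix.mulVec, dotProduct, mul_comm]⟩

/-- Used for s = ∅, the resolution itself, and for s = {6}, the nonzerodivisor property of x₁₂. -/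
theorem pfaffianExact_spec (s : Finset (Fin 10)) (hs : s ⊆ {3, 4, 5, 6, 7, 8, 9}) :
    PfaffianExact (spec s) := by
  refine PfaffianExact.of_union {3, 4, 5, 6, 7, 8, 9} ?_
  rw [Finset.union_eq_left.2 hs]
  exact pfaffianExact_artinian

theorem pfaffianExact_X : PfaffianExact (X : Fin 10 → MvPolynomial (Fin 10) ℂ) := by
  rw [← spec_empty]
  exact pfaffianExact_spec ∅ (Finset.empty_subset _)

theorem pfVec_skew_X_ne_zero : pfVec (skew (X : Fin 10 → MvPolynomial (Fin 10) ℂ)) 1 ≠ 0 := by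
  intro h
  have := congrArg (eval (fun i : Fin 10 => if i = 2 then (1 : ℂ) else 0)) h
  simp [pfVec_skew] at this

/-! ### The ideal of the cone -/

/-- The ideal generated by the Pfaffians. -/
def pfIdeal : Ideal (MvPolynomial (Fin 10) ℂ) := Ideal.span (Set.range (pfVec (skew X)))

theorem pfVec_mem_pfIdeal (i : Fin 5) : pfVec (skew X) i ∈ pfIdeal :=
  Ideal.subset_span ⟨i, rfl⟩

theorem mem_pfIdeal_iff (f : MvPolynomial (Fin 10) ℂ) :
    f ∈ pfIdeal ↔ ∃ c : Fin 5 → MvPolynomial (Fin 10) ℂ, pfVec (skew X) ⬝ᵥ c = f := by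
  rw [pfIdeal, Ideal.mem_span_range_iff_exists_fun]
  simp only [dotProduct, mul_comm]

/-- The coordinate `x₁₂` is a nonzerodivisor modulo the Pfaffians. -/
theorem mem_pfIdeal_of_X_mul_mem (f : MvPolynomial (Fin 10) ℂ) (hf : X 6 * f ∈ pfIdeal) :
    f ∈ pfIdeal := by
  rw [mem_pfIdeal_iff] at hf ⊢
  obtain ⟨c, hc⟩ := hf
  have hX := (pfaffianExact_spec {6} (by decide)).1
  have h1 : (skew (X : Fin 10 → MvPolynomial (Fin 10) ℂ)).map (killVar 6) = skew (spec {6}) := by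
    ext1 i j
    rw [Matrix.map_apply, skew_map, ← spec_empty, killVar_spec]
    rfl
  have h2 : (Matrix.of fun _ : Unit => pfVec (skew (X : Fin 10 → MvPolynomial (Fin 10) ℂ))).map
      (killVar 6) = Matrix.of fun _ : Unit => pfVec (skew (spec {6})) := by
    ext1 _ i
    rw [Matrix.map_apply, Matrix.of_apply, pfVec_map, h1]
    rfl
  rw [← h2, ← h1] at hX
  -- Modulo `X 6` the coefficients c form a syzygy, so c = Ab + X₆c'. The term Ab contributes
  -- nothing to the pairing with the Pfaffians, and X₆ cancels, giving f from c'.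
  obtain ⟨b, c', h⟩ := exists_eq_mulVec_add_X_smul 6 hX c fun _ => ⟨f, hc⟩
  refine ⟨c', mul_left_cancel₀ (X_ne_zero (6 : Fin 10)) ?_⟩
  have h' : c = (skew X).mulVec b + (X 6 : MvPolynomial (Fin 10) ℂ) • c' := funext h
  rw [← hc, h', dotProduct_add, pfVec_dotProduct_skew, zero_add, dotProduct_smul, smul_eq_mul]

theorem mem_pfIdeal_of_X_pow_mul_mem (n : ℕ) (f : MvPolynomial (Fin 10) ℂ)
    (hf : X 6 ^ n * f ∈ pfIdeal) : f ∈ pfIdeal := by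
  induction n with
  | zero => simpa using hf
  | succ n ih => exact ih (mem_pfIdeal_of_X_mul_mem _ (by rwa [← mul_assoc, ← pow_succ']))

/-- The `2 × 2` minors of the first two rows of an alternating matrix, as an alternating
matrix. -/
def minorCoord {T : Type*} [CommRing T] (m : Matrix (Fin 5) (Fin 5) T) : Fin 10 → T :=
  coordOf fun i j => m 0 i * m 1 j - m 0 j * m 1 i

theorem skew_minorCoord {T : Type*} [CommRing T] (m : Matrix (Fin 5) (Fin 5) T) (i j : Fin 5) :
    skew (minorCoord m) i j = m 0 i * m 1 j - m 0 j * m 1 i :=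
  skew_coordOf (fun i => by ring) (fun i j => by ring) i j

/-- x₁ᵢx₂ⱼ - x₁ⱼx₂ᵢ - x₁₂xᵢⱼ is minus the Pfaffian on rows 1, 2, i, j, or zero if i or j is 1 or 2.
Only the Pfaffians omitting 3, 4 or 5 occur. -/
theorem minorCoord_skew_sub_mem (k : Fin 10) :
    minorCoord (skew X) k - X 6 * X k ∈ pfIdeal := by
  have h : minorCoord (skew X) k - X 6 * X k =
      (![0, 0, 0, 0, 0, 0, 0, 0, -1, 0] : Fin 10 → MvPolynomial (Fin 10) ℂ) k *
        pfVec (skew X) 2 +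
      (![0, 0, 0, 0, 0, 1, 0, 0, 0, 0] : Fin 10 → MvPolynomial (Fin 10) ℂ) k *
        pfVec (skew X) 3 +
      (![0, 0, 0, 0, -1, 0, 0, 0, 0, 0] : Fin 10 → MvPolynomial (Fin 10) ℂ) k *
        pfVec (skew X) 4 := by
    simp only [pfVec_skew]
    fin_cases k <;> simp [minorCoord, coordOf, skew] <;> ring
  rw [h]
  exact add_mem (add_mem (Ideal.mul_mem_left _ _ (pfVec_mem_pfIdeal 2))
    (Ideal.mul_mem_left _ _ (pfVec_mem_pfIdeal 3))) (Ideal.mul_mem_left _ _ (pfVec_mem_pfIdeal 4))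

/-- The restriction of functions to the decomposable forms spanned by the first two rows of the
universal form. -/
def toMinors : MvPolynomial (Fin 10) ℂ →ₐ[ℂ] MvPolynomial (Fin 10) ℂ :=
  aeval (minorCoord (skew X))

theorem aeval_mul_of_isHomogeneous {σ T : Type*} [Fintype σ] [CommRing T] [Algebra ℂ T]
    {n : ℕ} {f : MvPolynomial σ ℂ} (hf : f.IsHomogeneous n) (t : T) (z : σ → T) :
    aeval (fun i => t * z i) f = t ^ n * aeval z f := by
  rw [aeval_def, aeval_def, eval₂_eq', eval₂_eq', Finset.mul_sum]
  refine Finset.sum_congr rfl fun d hd => ?_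
  have hdeg : ∑ i, d i = n := by
    rw [hf.degree_eq_sum_deg_support hd]
    exact (Finset.sum_subset (Finset.subset_univ _) (by simp)).symm
  simp only [mul_pow, Finset.prod_mul_distrib, Finset.prod_pow_eq_pow_sum, hdeg]
  ring

/-- Modulo the Pfaffians the substitution multiplies every variable by x₁₂, which scales a form of
degree n by x₁₂ⁿ. -/
theorem toMinors_sub_mem {n : ℕ} {f : MvPolynomial (Fin 10) ℂ} (hf : f.IsHomogeneous n) :
    toMinors f - X 6 ^ n * f ∈ pfIdeal := by
  rw [← Ideal.Quotient.mk_eq_mk_iff_sub_mem]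
  set π := Ideal.Quotient.mkₐ ℂ pfIdeal
  change π (toMinors f) = π (X 6 ^ n * f)
  have h1 : π (toMinors f) = aeval (fun i => π (X 6) * π (X i)) f := by
    rw [toMinors, comp_aeval_apply]
    congr 2
    ext1 i
    rw [← map_mul]
    exact Ideal.Quotient.mk_eq_mk_iff_sub_mem _ _ |>.2 (minorCoord_skew_sub_mem i)
  rw [h1, aeval_mul_of_isHomogeneous hf, map_mul, map_pow]
  conv_rhs => rw [← aeval_X_left_apply f, comp_aeval_apply]

theorem mem_pfIdeal_of_toMinors_eq_zero (f : MvPolynomial (Fin 10) ℂ) (hf : toMinors f = 0) :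
    f ∈ pfIdeal := by
  have hS := skew_isHomogeneous (isHomogeneous_X (σ := Fin 10) ℂ)
  have hd (i j) : (skew X 0 i * skew X 1 j - skew X 0 j * skew X 1 i :
      MvPolynomial (Fin 10) ℂ).IsHomogeneous 2 :=
    ((hS 0 i).mul (hS 1 j)).sub ((hS 0 j).mul (hS 1 i))
  have hq (i) : (minorCoord (skew (X : Fin 10 → MvPolynomial (Fin 10) ℂ)) i).IsHomogeneous 2 := by
    fin_cases i
    exacts [hd 1 3, hd 1 4, hd 0 3, (hd 0 2).add (hd 1 3), (hd 2 3).sub (hd 1 4),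
      (hd 2 4).add (hd 0 3), hd 0 1, hd 1 2, hd 3 4, hd 0 4]
  -- The substitution doubles degrees, so its kernel is graded and f may be treated one degree at a
  -- time.
  have hcomp (n : ℕ) : toMinors (homogeneousComponent n f) = 0 := by
    have hm (m : ℕ) : homogeneousComponent (2 * n) (toMinors (homogeneousComponent m f)) =
        if m = n then toMinors (homogeneousComponent m f) else 0 := by
      rw [toMinors, homogeneousComponent_of_mem ((mem_homogeneousSubmodule _ _).2
        ((homogeneousComponent_isHomogeneous m f).aeval _ hq))]
      exact if_congr (by omega) rfl rfl
    have h := congrArg (homogeneousComponent (2 * n)) hf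
    rw [← sum_homogeneousComponent f, map_sum, map_sum, map_zero] at h
    simp only [hm, Finset.sum_ite_eq'] at h
    split_ifs at h with hn
    · exact h
    · rw [homogeneousComponent_eq_zero _ _ (by simp at hn; omega), map_zero]
  rw [← sum_homogeneousComponent f]
  refine sum_mem fun n _ => mem_pfIdeal_of_X_pow_mul_mem n _ ?_
  have := toMinors_sub_mem (homogeneousComponent_isHomogeneous n f)
  rwa [hcomp, zero_sub, neg_mem_iff] at this

end Resolution

/-! ### Coordinates on the ambient affine space -/

section Coordinates

open MvPolynomial

theorem span_range_e : Submodule.span ℂ (Set.range e) = ⊤ := by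
  have : e = Pi.basisFun ℂ (Fin 5) := by
    ext1 i
    simp [e]
  rw [this, Module.Basis.span_eq]

theorem vec_eq_sum (v : V) : v = ∑ i, v i • e i := by
  ext j
  simp [e, Pi.single_apply]

theorem ext_eq_top_of_mem {n : ℕ} (p : Submodule ℂ (Ext n))
    (h : ∀ k : Fin n → Fin 5, exteriorPower.ιMulti ℂ n (fun i => e (k i)) ∈ p) : p = ⊤ := by
  rw [eq_top_iff, ← exteriorPower.ιMulti_span_of_span ℂ n V span_range_e, Submodule.span_le]
  rintro _ ⟨a, ha, rfl⟩
  choose k hk using fun i => ha ⟨i, rfl⟩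
  have : a = fun i => e (k i) := funext fun i => (hk i).symm
  rw [this]
  exact h k

theorem wedge_swap (v w : V) : wedge v w = -wedge w v := by
  unfold wedge
  rw [← AlternatingMap.map_swap _ _ (show (0 : Fin 2) ≠ 1 by decide)]
  congr 1
  ext i
  fin_cases i <;> rfl

theorem wedge_self (v : V) : wedge v v = 0 :=
  AlternatingMap.map_eq_zero_of_eq _ _ (i := 0) (j := 1) rfl (by decide)

theorem ext_two_eq_top_of_mem (p : Submodule ℂ (Ext 2))
    (h : ∀ i j, i < j → wedge (e i) (e j) ∈ p) : p = ⊤ := by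
  refine ext_eq_top_of_mem p fun k => ?_
  have hk : exteriorPower.ιMulti ℂ 2 (fun i => e (k i)) = wedge (e (k 0)) (e (k 1)) := by
    unfold wedge
    congr 1
    ext i
    fin_cases i <;> rfl
  rw [hk]
  rcases lt_trichotomy (k 0) (k 1) with hij | hij | hij
  · exact h _ _ hij
  · rw [hij, wedge_self]
    exact p.zero_mem
  · rw [wedge_swap]
    exact Submodule.neg_mem p (h _ _ hij)

/-- The exterior squares of the basis vectors in the chosen coordinates. -/
def wedgeCoord : Fin 10 → Ext 2 := coordOf fun i j => wedge (e i) (e j)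

/-- The change of coordinates is triangular: 03, 13 and 14 are themselves coordinates, and they
correct the mixed ones 02, 23 and 24. -/
theorem ext_two_eq_top_of_wedgeCoord_mem (p : Submodule ℂ (Ext 2)) (h : ∀ k, wedgeCoord k ∈ p) :
    p = ⊤ := by
  refine ext_two_eq_top_of_mem p ?_
  have h0 : wedge (e 1) (e 3) ∈ p := h 0
  have h1 : wedge (e 1) (e 4) ∈ p := h 1
  have h2 : wedge (e 0) (e 3) ∈ p := h 2
  have h3 : wedge (e 0) (e 2) ∈ p := (Submodule.add_mem_iff_left p h0).1 (h 3)
  have h4 : wedge (e 2) (e 3) ∈ p := (Submodule.sub_mem_iff_left p h1).1 (h 4)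
  have h5 : wedge (e 2) (e 4) ∈ p := (Submodule.add_mem_iff_left p h2).1 (h 5)
  have h6 : wedge (e 0) (e 1) ∈ p := h 6
  have h7 : wedge (e 1) (e 2) ∈ p := h 7
  have h8 : wedge (e 3) (e 4) ∈ p := h 8
  have h9 : wedge (e 0) (e 4) ∈ p := h 9
  intro i j hij
  fin_cases i <;> fin_cases j <;> first | exact absurd hij (by decide) | assumption

/-- A basis of the exterior square. -/
def wedgeBasis : Module.Basis (Fin 10) ℂ (Ext 2) :=
  basisOfTopLeSpanOfCardEqFinrank wedgeCoord
    (ext_two_eq_top_of_wedgeCoord_mem _ fun k => Submodule.subset_span (Set.mem_range_self k)).ge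
    (by
      rw [exteriorPower.finrank_eq, Module.finrank_fin_fun, Fintype.card_fin]
      decide)

/-- A basis of the space of linear functions. -/
def linBasis : Module.Basis (Fin 10) ℂ Lin :=
  wedgeBasis.map (TensorProduct.rid ℂ (Ext 2)).symm

theorem linBasis_apply (k : Fin 10) : linBasis k = wedgeCoord k ⊗ₜ[ℂ] (1 : L) := by
  rw [linBasis, Module.Basis.map_apply, wedgeBasis, coe_basisOfTopLeSpanOfCardEqFinrank]
  rfl

/-- The coordinate ring of the ambient space is a polynomial ring in ten variables. -/
def coordEquiv : O ≃ₐ[ℂ] MvPolynomial (Fin 10) ℂ :=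
  SymmetricAlgebra.equivMvPolynomial linBasis

/-- The linear function given by an element of the exterior square. -/
def linFun : Ext 2 →ₗ[ℂ] O :=
  SymmetricAlgebra.ι ℂ Lin ∘ₗ (TensorProduct.mk ℂ (Ext 2) L).flip 1

/-- The bridge by which identities for `skew` over an arbitrary ring reach `O`. -/
theorem genericSkew_eq_skew :
    genericSkew = skew fun k => SymmetricAlgebra.ι ℂ Lin (linBasis k) := by
  have h : (fun k => SymmetricAlgebra.ι ℂ Lin (linBasis k)) = coordOf genericSkew := by
    ext1 k
    rw [linBasis_apply]
    exact map_coordOf linFun.toAddMonoidHom _ k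
  rw [h]
  ext1 i j
  exact (skew_coordOf (d := genericSkew) (fun i => x_self _) (fun i j => x_swap _ _) i j).symm

theorem coordEquiv_genericSkew (i j : Fin 5) : coordEquiv (genericSkew i j) = skew X i j := by
  rw [genericSkew_eq_skew, skew_map]
  have h : (fun k => coordEquiv (SymmetricAlgebra.ι ℂ Lin (linBasis k))) = X :=
    funext fun k => SymmetricAlgebra.equivMvPolynomial_ι_apply _ _
  rw [h]

theorem genericSkew_map_coordEquiv : genericSkew.map coordEquiv = skew X := by
  ext1 i j
  exact coordEquiv_genericSkew i j

theorem coordEquiv_pfaffian (i : Fin 5) : coordEquiv (pfaffian i) = pfVec (skew X) i := by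
  rw [pfaffian_eq_pfVec, pfVec_map, genericSkew_map_coordEquiv]

theorem coordEquiv_mulVec (b : Fin 5 → O) :
    (fun i => coordEquiv (genericSkew.mulVec b i)) = (skew X).mulVec fun j => coordEquiv (b j) := by
  ext1 i
  simp [Matrix.mulVec, dotProduct, coordEquiv_genericSkew]

theorem pfaffian_dotProduct_mulVec (b : Fin 5 → O) :
    ∑ i, genericSkew.mulVec b i * pfaffian i = 0 := by
  have := pfVec_dotProduct_skew (fun k => SymmetricAlgebra.ι ℂ Lin (linBasis k)) b
  rw [← genericSkew_eq_skew] at this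
  rw [← this, pfaffian_eq_pfVec]
  exact Finset.sum_congr rfl fun i _ => mul_comm _ _

theorem genericSkew_mulVec_pfaffian : genericSkew.mulVec pfaffian = 0 := by
  rw [pfaffian_eq_pfVec, genericSkew_eq_skew, skew_mulVec_pfVec]

/-- The generic alternating matrix gives the syzygies of the Pfaffians. -/
theorem sum_mul_pfaffian_eq_zero_iff (c : Fin 5 → O) :
    ∑ i, c i * pfaffian i = 0 ↔ ∃ b, c = genericSkew.mulVec b := by
  constructor
  · intro h
    obtain ⟨b, hb⟩ := pfaffianExact_X.exists_eq_skew_mulVec (fun i => coordEquiv (c i)) <| by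
      have := congrArg coordEquiv h
      simpa [dotProduct, coordEquiv_pfaffian, mul_comm] using this
    refine ⟨fun j => coordEquiv.symm (b j), funext fun i => coordEquiv.injective ?_⟩
    have h2 := congrFun (coordEquiv_mulVec fun j => coordEquiv.symm (b j)) i
    simp only [AlgEquiv.apply_symm_apply] at h2
    rw [h2]
    exact congrFun hb i
  · rintro ⟨b, rfl⟩
    exact pfaffian_dotProduct_mulVec b

theorem genericSkew_mulVec_eq_zero_iff (b : Fin 5 → O) :
    genericSkew.mulVec b = 0 ↔ ∃ t : O, b = t • pfaffian := by
  constructor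
  · intro h
    obtain ⟨t, ht⟩ := pfaffianExact_X.exists_eq_smul (fun i => coordEquiv (b i)) <| by
      rw [← coordEquiv_mulVec, h]
      simp only [Pi.zero_apply, map_zero]
      rfl
    refine ⟨coordEquiv.symm t, funext fun i => coordEquiv.injective ?_⟩
    simpa [coordEquiv_pfaffian] using congrFun ht i
  · rintro ⟨t, rfl⟩
    rw [Matrix.mulVec_smul, genericSkew_mulVec_pfaffian, smul_zero]

theorem eq_zero_of_smul_pfaffian_eq_zero (t : O) (h : t • pfaffian = 0) : t = 0 := by
  have := congrArg coordEquiv (congrFun h 1)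
  rw [Pi.smul_apply, smul_eq_mul, map_mul, coordEquiv_pfaffian, Pi.zero_apply, map_zero,
    mul_eq_zero] at this
  exact coordEquiv.map_eq_zero_iff.1 (this.resolve_right pfVec_skew_X_ne_zero)

/-! ### The ideal of the affine cone -/

/-- The point `a ∧ b` of the affine cone. -/
def decomposable (a b : Module.Dual ℂ V) : Pt :=
  TensorProduct.lift ((LinearMap.lsmul ℂ ℂ).flip ∘ₗ exteriorPower.pairingDual ℂ V 2
    (exteriorPower.ιMulti ℂ 2 ![a, b]))

theorem decomposable_wedge (a b : Module.Dual ℂ V) (v w : V) (l : L) :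
    decomposable a b (wedge v w ⊗ₜ[ℂ] l) = (a v * b w - a w * b v) * l := by
  simp [decomposable, wedge, exteriorPower.pairingDual_ιMulti_ιMulti, Matrix.det_fin_two]
  ring

theorem decomposable_mem_aGr (a b : Module.Dual ℂ V) : decomposable a b ∈ aGr :=
  ⟨a, b, decomposable_wedge a b⟩

/-- On xᵢⱼ = aᵢbⱼ - aⱼbᵢ the 4 × 4 Pfaffians are the Plücker relations, which hold identically. -/
theorem pfaffian_mem_idealGr (i : Fin 5) : pfaffian i ∈ idealGr := by
  rintro p ⟨a, b, h⟩
  have hx (i j) : evalPt p (genericSkew i j) = a (e i) * b (e j) - a (e j) * b (e i) := by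
    have := h (e i) (e j) 1
    rw [mul_one] at this
    rw [← this]
    exact SymmetricAlgebra.lift_ι_apply _ _
  rw [pfaffian_eq_pfVec, pfVec_map]
  simp only [pfVec, Matrix.map_apply, hx]
  ring

/-- The value of `toMinors f` at q is the value of f at the cone point r₀ ∧ r₁, with rᵢ the rows of
the skew matrix at q. A polynomial over the infinite field ℂ vanishing at every q is zero. -/
theorem toMinors_coordEquiv_eq_zero (f : O) (hf : f ∈ idealGr) : toMinors (coordEquiv f) = 0 := by
  refine MvPolynomial.funext fun q => ?_
  rw [map_zero]
  let r (i : Fin 5) : Module.Dual ℂ V := ∑ j, eval q (skew X i j) • eDual j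
  have hr (i j) : r i (e j) = eval q (skew X i j) := by
    simp [r, eDual, e, Pi.single_apply]
  have hgen (i j) : toMinors (skew X i j) = skew X 0 i * skew X 1 j - skew X 0 j * skew X 1 i := by
    have hX : (fun k => toMinors (X k)) = minorCoord (skew X) := funext fun k => aeval_X _ _
    rw [skew_map, hX, skew_minorCoord]
  -- The two evaluations are algebra maps out of a symmetric algebra, so agreement on the vectors eᵢ
  -- ∧ eⱼ suffices.
  have this : ((aeval q).comp (toMinors.comp coordEquiv.toAlgHom) : O →ₐ[ℂ] ℂ).toLinearMap ∘ₗ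
      linFun = (evalPt (decomposable (r 0) (r 1))).toLinearMap ∘ₗ linFun := by
    rw [← LinearMap.eqLocus_eq_top]
    refine ext_two_eq_top_of_mem _ fun i j _ => ?_
    change eval q (toMinors (coordEquiv (genericSkew i j))) =
      evalPt (decomposable (r 0) (r 1)) (genericSkew i j)
    have h2 : evalPt (decomposable (r 0) (r 1)) (genericSkew i j) =
        decomposable (r 0) (r 1) (wedge (e i) (e j) ⊗ₜ[ℂ] (1 : L)) :=
      SymmetricAlgebra.lift_ι_apply _ _
    rw [coordEquiv_genericSkew, hgen, h2, decomposable_wedge, hr, hr, hr, hr]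
    simp
  have h : ((aeval q).comp (toMinors.comp coordEquiv.toAlgHom) : O →ₐ[ℂ] ℂ) =
      evalPt (decomposable (r 0) (r 1)) := by
    apply SymmetricAlgebra.algHom_ext
    refine linBasis.ext fun k => ?_
    rw [linBasis_apply]
    exact LinearMap.congr_fun (f := ((aeval q).comp
      (toMinors.comp coordEquiv.toAlgHom) : O →ₐ[ℂ] ℂ).toLinearMap ∘ₗ linFun)
      (g := (evalPt (decomposable (r 0) (r 1))).toLinearMap ∘ₗ linFun) (this) (wedgeCoord k)
  have := congrArg (fun F : O →ₐ[ℂ] ℂ => F f) h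
  exact this.trans (hf _ (decomposable_mem_aGr _ _))

/-- The ideal of the affine cone is generated by the Pfaffians. -/
theorem idealGr_eq_span : idealGr = Ideal.span (Set.range pfaffian) := by
  apply le_antisymm
  · intro f hf
    obtain ⟨c, hc⟩ := (mem_pfIdeal_iff _).1
      (mem_pfIdeal_of_toMinors_eq_zero _ (toMinors_coordEquiv_eq_zero f hf))
    rw [Ideal.mem_span_range_iff_exists_fun]
    refine ⟨fun i => coordEquiv.symm (c i), coordEquiv.injective ?_⟩
    rw [← hc]
    simp [dotProduct, coordEquiv_pfaffian, mul_comm]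
  · rw [Ideal.span_le]
    rintro _ ⟨i, rfl⟩
    exact pfaffian_mem_idealGr i

end Coordinates

/-! ### The wedge square of the universal form -/

/-- Splitting off the image of 0 reduces the 24-term signed sum to sums over smaller symmetric
groups. -/
theorem sum_perm_fin_succ {n : ℕ} {M : Type*} [AddCommMonoid M]
    (f : Equiv.Perm (Fin (n + 1)) → M) :
    ∑ σ, f σ = ∑ i, ∑ τ : Equiv.Perm (Fin n), f (Equiv.Perm.decomposeFin.symm (i, τ)) := by
  rw [← Equiv.sum_comp Equiv.Perm.decomposeFin.symm, Fintype.sum_prod_type]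

theorem sum_sign_smul_fin_two {M : Type*} [AddCommGroup M] (f : Fin 2 → Fin 2 → M) :
    ∑ σ : Equiv.Perm (Fin 2), Equiv.Perm.sign σ • f (σ 0) (σ 1) = f 0 1 - f 1 0 := by
  rw [show (Finset.univ : Finset (Equiv.Perm (Fin 2))) = {1, Equiv.swap 0 1} by decide,
    Finset.sum_pair (by decide)]
  simp [sub_eq_add_neg]

theorem sum_sign_smul_fin_three {M : Type*} [AddCommGroup M] (f : Fin 3 → Fin 3 → Fin 3 → M) :
    ∑ σ : Equiv.Perm (Fin 3), Equiv.Perm.sign σ • f (σ 0) (σ 1) (σ 2) =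
      f 0 1 2 - f 0 2 1 - (f 1 0 2 - f 1 2 0) - (f 2 1 0 - f 2 0 1) := by
  have h1 (i) (τ : Equiv.Perm (Fin 2)) : Equiv.Perm.decomposeFin.symm (i, τ) 1 =
    Equiv.swap 0 i (τ 0).succ := Equiv.Perm.decomposeFin_symm_apply_succ τ i 0
  have h2 (i) (τ : Equiv.Perm (Fin 2)) : Equiv.Perm.decomposeFin.symm (i, τ) 2 =
    Equiv.swap 0 i (τ 1).succ := Equiv.Perm.decomposeFin_symm_apply_succ τ i 1
  rw [sum_perm_fin_succ]
  simp only [h1, h2, Equiv.Perm.decomposeFin_symm_apply_zero, Equiv.Perm.decomposeFin.symm_sign,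
    mul_smul, ← Finset.smul_sum]
  have key (i : Fin 3) := sum_sign_smul_fin_two
    fun a b => f i (Equiv.swap 0 i a.succ) (Equiv.swap 0 i b.succ)
  simp only [key]
  simp [Fin.sum_univ_three, Equiv.swap_apply_def]
  abel

theorem sum_sign_smul_fin_four {M : Type*} [AddCommGroup M]
    (f : Fin 4 → Fin 4 → Fin 4 → Fin 4 → M) :
    ∑ σ : Equiv.Perm (Fin 4), Equiv.Perm.sign σ • f (σ 0) (σ 1) (σ 2) (σ 3) =
      ∑ i, (if i = 0 then (1 : ℤˣ) else -1) • ∑ τ : Equiv.Perm (Fin 3), Equiv.Perm.sign τ •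
        f i (Equiv.swap 0 i (τ 0).succ) (Equiv.swap 0 i (τ 1).succ)
          (Equiv.swap 0 i (τ 2).succ) := by
  have h1 (i) (τ : Equiv.Perm (Fin 3)) : Equiv.Perm.decomposeFin.symm (i, τ) 1 =
    Equiv.swap 0 i (τ 0).succ := Equiv.Perm.decomposeFin_symm_apply_succ τ i 0
  have h2 (i) (τ : Equiv.Perm (Fin 3)) : Equiv.Perm.decomposeFin.symm (i, τ) 2 =
    Equiv.swap 0 i (τ 1).succ := Equiv.Perm.decomposeFin_symm_apply_succ τ i 1
  have h3 (i) (τ : Equiv.Perm (Fin 3)) : Equiv.Perm.decomposeFin.symm (i, τ) 3 =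
    Equiv.swap 0 i (τ 2).succ := Equiv.Perm.decomposeFin_symm_apply_succ τ i 2
  rw [sum_perm_fin_succ]
  simp only [h1, h2, h3, Equiv.Perm.decomposeFin_symm_apply_zero,
    Equiv.Perm.decomposeFin.symm_sign, mul_smul, ← Finset.smul_sum]

/-- The 24 permutations form three classes of eight, one for each perfect matching of four points,
and the signed term is constant on each class. -/
theorem sum_sign_smul_mul {T M : Type*} [CommRing T] (X : M → M → T)
    (hX : ∀ v w, X v w = -X w v) (v : Fin 4 → M) :
    ∑ σ : Equiv.Perm (Fin 4), Equiv.Perm.sign σ •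
      (X (v (σ 0)) (v (σ 1)) * X (v (σ 2)) (v (σ 3))) =
    8 * (X (v 0) (v 1) * X (v 2) (v 3) - X (v 0) (v 2) * X (v 1) (v 3)
      + X (v 0) (v 3) * X (v 1) (v 2)) := by
  rw [sum_sign_smul_fin_four fun a b c d => X (v a) (v b) * X (v c) (v d)]
  have key (i : Fin 4) := sum_sign_smul_fin_three fun a b c =>
    X (v i) (v (Equiv.swap 0 i a.succ)) * X (v (Equiv.swap 0 i b.succ)) (v (Equiv.swap 0 i c.succ))
  simp only [key]
  simp [Fin.sum_univ_four, Equiv.swap_apply_def]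
  rw [hX (v 1) (v 0), hX (v 2) (v 0), hX (v 3) (v 0), hX (v 2) (v 1), hX (v 3) (v 1),
    hX (v 3) (v 2)]
  ring

/-- The alternatization of ξ ⊗ ξ is 2!·2! times the shuffle product, and after multiplication it is
8 times the Pfaffian. The factor 4 cancels because it is a unit in a ℂ-algebra. -/
theorem mul_domCoprod_self {M T : Type*} [AddCommGroup M] [Module ℂ M] [CommRing T] [Algebra ℂ T]
    (ξ : M [⋀^Fin 2]→ₗ[ℂ] T) (v : Fin 4 → M) :
    ((LinearMap.mul' ℂ T).compAlternatingMap (ξ.domCoprod ξ)).domDomCongr finSumFinEquiv v =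
      2 * (ξ ![v 0, v 1] * ξ ![v 2, v 3] - ξ ![v 0, v 2] * ξ ![v 1, v 3]
        + ξ ![v 0, v 3] * ξ ![v 1, v 2]) := by
  have h := MultilinearMap.domCoprod_alternization_eq ξ ξ
  have h2 := congrArg (fun F => LinearMap.mul' ℂ T (F fun i => v (finSumFinEquiv i))) h
  rw [MultilinearMap.alternatization_apply, map_sum, AlternatingMap.smul_apply, map_nsmul,
    ← Equiv.sum_comp (finSumFinEquiv (m := 2) (n := 2)).permCongr.symm] at h2
  have h3 (σ : Equiv.Perm (Fin 4)) : LinearMap.mul' ℂ T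
      (Equiv.Perm.sign ((finSumFinEquiv (m := 2) (n := 2)).permCongr.symm σ) •
        MultilinearMap.domDomCongr ((finSumFinEquiv (m := 2) (n := 2)).permCongr.symm σ)
          (MultilinearMap.domCoprod (ξ : MultilinearMap ℂ (fun _ : Fin 2 => M) T)
            (ξ : MultilinearMap ℂ (fun _ : Fin 2 => M) T)) fun i => v (finSumFinEquiv i)) =
      Equiv.Perm.sign σ • (ξ ![v (σ 0), v (σ 1)] * ξ ![v (σ 2), v (σ 3)]) := by
    have hv : (fun i : Fin 2 => v (σ (Fin.castAdd 2 i))) = ![v (σ 0), v (σ 1)] := by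
      ext i : 1
      fin_cases i <;> rfl
    have hv' : (fun i : Fin 2 => v (σ (Fin.natAdd 2 i))) = ![v (σ 2), v (σ 3)] := by
      ext i : 1
      fin_cases i <;> rfl
    rw [Equiv.permCongr_symm, Equiv.Perm.sign_permCongr, Units.smul_def, map_zsmul, ← hv, ← hv',
      ← Units.smul_def]
    simp [-Fin.natAdd_eq_addNat]
    rfl
  have hswap (v w : M) : ξ ![v, w] = -ξ ![w, v] := by
    rw [← AlternatingMap.map_swap ξ ![w, v] (show (0 : Fin 2) ≠ 1 by decide)]
    congr 1
    ext i
    fin_cases i <;> rfl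
  simp only [h3] at h2
  rw [sum_sign_smul_mul (fun v w => ξ ![v, w]) hswap] at h2
  have h4 : (4 : T) * LinearMap.mul' ℂ T (ξ.domCoprod ξ fun i => v (finSumFinEquiv i)) =
      4 * (2 * (ξ ![v 0, v 1] * ξ ![v 2, v 3] - ξ ![v 0, v 2] * ξ ![v 1, v 3]
        + ξ ![v 0, v 3] * ξ ![v 1, v 2])) := by
    rw [← mul_assoc]
    norm_num at h2 ⊢
    exact h2.symm
  have hu : IsUnit (4 : T) := by
    have := (IsUnit.mk0 (4 : ℂ) (by norm_num)).map (algebraMap ℂ T)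
    rwa [map_ofNat] at this
  exact hu.mul_left_cancel h4

theorem two_smul_pfForm : (2 : ℂ) • pfForm = ((LinearMap.mul' ℂ O).compAlternatingMap
    (xForm.domCoprod xForm)).domDomCongr finSumFinEquiv := by
  ext v
  refine Eq.trans ?_ (mul_domCoprod_self xForm v).symm
  rw [AlternatingMap.smul_apply, two_smul, ← two_mul]
  rfl

/-! ### The contraction -/

theorem contract_tmul (φ : Module.Dual ℂ V) (v : Fin 5 → V) :
    contract (φ ⊗ₜ[ℂ] exteriorPower.ιMulti ℂ 5 v) =
      ∑ i : Fin 5, (-1 : ℤ) ^ (i : ℕ) • φ (v i) • exteriorPower.ιMulti ℂ 4 (i.removeNth v) := by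
  rw [contract, TensorProduct.lift.tmul]
  change exteriorPower.alternatingMapLinearEquiv (AlternatingMap.alternatizeUncurryFin _) _ = _
  rw [exteriorPower.alternatingMapLinearEquiv_apply_ιMulti,
    AlternatingMap.alternatizeUncurryFin_apply]
  rfl

theorem contract_surjective : Function.Surjective contract := by
  rw [← LinearMap.range_eq_top]
  refine ext_eq_top_of_mem _ fun k => ?_
  by_cases hk : Function.Injective k
  · obtain ⟨i, hi⟩ : ∃ i, ∀ j, k j ≠ i := by
      by_contra! h
      have := Fintype.card_le_of_surjective k h
      simp at this
    -- Four distinct indices miss some i; contracting eᵢ ∧ (the given vector) with eᵢ^∨ leaves only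
    -- the leading term.
    refine ⟨eDual i ⊗ₜ[ℂ] exteriorPower.ιMulti ℂ 5 (Fin.cons (e i) fun j => e (k j)), ?_⟩
    rw [contract_tmul, Fin.sum_univ_succ, Finset.sum_eq_zero]
    · simp [eDual, e]
    · intro j _
      simp [eDual, e, (hi j).symm]
  · obtain ⟨a, b, hab, hne⟩ : ∃ a b, k a = k b ∧ a ≠ b := by
      simpa [Function.Injective] using hk
    rw [AlternatingMap.map_eq_zero_of_eq _ _ (by rw [hab]) hne]
    exact Submodule.zero_mem _

/-- Both sides have dimension 5, so surjectivity suffices. -/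
theorem contract_bijective : Function.Bijective contract := by
  refine ⟨?_, contract_surjective⟩
  refine (LinearMap.injective_iff_surjective_of_finrank_eq_finrank ?_).2 contract_surjective
  rw [Module.finrank_tensorProduct, Subspace.dual_finrank_eq, exteriorPower.finrank_eq,
    exteriorPower.finrank_eq, Module.finrank_fin_fun]
  decide

theorem contractD_bijective : Function.Bijective contractD := by
  have : contractD = ((TensorProduct.assoc ℂ (Module.Dual ℂ V) (Ext 5) (L ⊗[ℂ] L)).symm.trans
      (TensorProduct.congr (LinearEquiv.ofBijective contract contract_bijective)
        (LinearEquiv.refl ℂ (L ⊗[ℂ] L)))).toLinearMap := rfl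
  rw [this]
  exact LinearEquiv.bijective _

theorem rhoExt_ιMulti (n : ℕ) (g : G) (v : Fin n → V) :
    rhoExt n g (exteriorPower.ιMulti ℂ n v) = exteriorPower.ιMulti ℂ n fun i => rhoV g (v i) :=
  exteriorPower.map_apply_ιMulti _ _

theorem rhoV_dual_apply (g : G) (φ : Module.Dual ℂ V) (v : V) :
    rhoV.dual g φ (rhoV g v) = φ v := by
  simp [Representation.dual_apply, Module.Dual.transpose_apply]

theorem contract_equivariant (g : G) (φ : Module.Dual ℂ V) (w : Ext 5) :
    contract (rhoV.dual g φ ⊗ₜ[ℂ] rhoExt 5 g w) = rhoExt 4 g (contract (φ ⊗ₜ[ℂ] w)) := by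
  suffices h : contract ∘ₗ TensorProduct.mk ℂ _ _ (rhoV.dual g φ) ∘ₗ rhoExt 5 g =
      rhoExt 4 g ∘ₗ contract ∘ₗ TensorProduct.mk ℂ _ _ φ from LinearMap.congr_fun h w
  apply exteriorPower.linearMap_ext
  ext1 v
  change contract (rhoV.dual g φ ⊗ₜ[ℂ] rhoExt 5 g (exteriorPower.ιMulti ℂ 5 v)) =
    rhoExt 4 g (contract (φ ⊗ₜ[ℂ] exteriorPower.ιMulti ℂ 5 v))
  rw [rhoExt_ιMulti, contract_tmul, contract_tmul, map_sum]
  refine Finset.sum_congr rfl fun i _ => ?_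
  rw [rhoV_dual_apply, map_zsmul, map_smul, rhoExt_ιMulti]
  rfl

theorem contractD_equivariant (g : G) (t : Module.Dual ℂ V ⊗[ℂ] D) :
    contractD (rhoV.dual.tprod rhoD g t) =
      (rhoExt 4).tprod (rhoL.tprod rhoL) g (contractD t) := by
  suffices h : contractD ∘ₗ rhoV.dual.tprod rhoD g =
      (rhoExt 4).tprod (rhoL.tprod rhoL) g ∘ₗ contractD from LinearMap.congr_fun h t
  refine TensorProduct.ext' fun φ d => ?_
  suffices h : contractD ∘ₗ rhoV.dual.tprod rhoD g ∘ₗ TensorProduct.mk ℂ _ _ φ =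
      (rhoExt 4).tprod (rhoL.tprod rhoL) g ∘ₗ contractD ∘ₗ TensorProduct.mk ℂ _ _ φ from
    LinearMap.congr_fun h d
  refine TensorProduct.ext' fun w s => ?_
  change contract (rhoV.dual g φ ⊗ₜ[ℂ] rhoExt 5 g w) ⊗ₜ[ℂ] rhoL.tprod rhoL g s =
    rhoExt 4 g (contract (φ ⊗ₜ[ℂ] w)) ⊗ₜ[ℂ] rhoL.tprod rhoL g s
  rw [contract_equivariant]

/-! ### Equivariance of the Pfaffian -/

theorem rhoO_x (g : G) (v w : V) :
    rhoO g (x v w) = (g.2 : ℂ) • x (rhoV g v) (rhoV g w) := by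
  have h : rhoO g (x v w) = SymmetricAlgebra.ι ℂ Lin (rhoLin g (wedge v w ⊗ₜ[ℂ] (1 : L))) :=
    SymmetricAlgebra.lift_ι_apply _ _
  have h2 : rhoL g 1 = (g.2 : ℂ) • (1 : L) := rfl
  rw [h, rhoLin_wedge, h2, TensorProduct.tmul_smul, map_smul]
  rfl

theorem rhoO_mul (g : G) (a b : O) : rhoO g (a * b) = rhoO g a * rhoO g b :=
  map_mul (actO g) a b

/-- The Pfaffian is quadratic in x, and each x carries one factor of the scalar; the twist L²
absorbs the square. -/
theorem rhoO_pfForm (g : G) (v : Fin 4 → V) :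
    rhoO g (pfForm v) = ((g.2 : ℂ) * g.2) • pfForm fun i => rhoV g (v i) := by
  change rhoO g (x (v 0) (v 1) * x (v 2) (v 3) - x (v 0) (v 2) * x (v 1) (v 3)
    + x (v 0) (v 3) * x (v 1) (v 2)) = _ • (_ * _ - _ * _ + _ * _)
  rw [map_add, map_sub]
  simp only [rhoO_mul, rhoO_x, smul_mul_smul_comm, smul_add, smul_sub]

theorem pf4_tmul (u : Ext 4) (l l' : L) :
    pf4 (u ⊗ₜ[ℂ] (l ⊗ₜ[ℂ] l')) =
      (l * l') • exteriorPower.alternatingMapLinearEquiv pfForm u := rfl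

theorem pf4_equivariant (g : G) (t : Ext 4 ⊗[ℂ] (L ⊗[ℂ] L)) :
    pf4 ((rhoExt 4).tprod (rhoL.tprod rhoL) g t) = rhoO g (pf4 t) := by
  have key (u : Ext 4) : ((g.2 : ℂ) * g.2) •
      exteriorPower.alternatingMapLinearEquiv pfForm (rhoExt 4 g u) =
      rhoO g (exteriorPower.alternatingMapLinearEquiv pfForm u) := by
    suffices h : ((g.2 : ℂ) * g.2) •
        (exteriorPower.alternatingMapLinearEquiv pfForm ∘ₗ rhoExt 4 g) =
        rhoO g ∘ₗ exteriorPower.alternatingMapLinearEquiv pfForm from LinearMap.congr_fun h u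
    apply exteriorPower.linearMap_ext
    ext1 v
    change ((g.2 : ℂ) * g.2) • exteriorPower.alternatingMapLinearEquiv pfForm
        (rhoExt 4 g (exteriorPower.ιMulti ℂ 4 v)) =
      rhoO g (exteriorPower.alternatingMapLinearEquiv pfForm (exteriorPower.ιMulti ℂ 4 v))
    rw [rhoExt_ιMulti, exteriorPower.alternatingMapLinearEquiv_apply_ιMulti,
      exteriorPower.alternatingMapLinearEquiv_apply_ιMulti, rhoO_pfForm]
  suffices h : pf4 ∘ₗ (rhoExt 4).tprod (rhoL.tprod rhoL) g = rhoO g ∘ₗ pf4 from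
    LinearMap.congr_fun h t
  refine TensorProduct.ext' fun u s => ?_
  suffices h : pf4 ∘ₗ (rhoExt 4).tprod (rhoL.tprod rhoL) g ∘ₗ TensorProduct.mk ℂ _ _ u =
      rhoO g ∘ₗ pf4 ∘ₗ TensorProduct.mk ℂ _ _ u from LinearMap.congr_fun h s
  refine TensorProduct.ext' fun l l' => ?_
  change pf4 (rhoExt 4 g u ⊗ₜ[ℂ] (((g.2 : ℂ) * l) ⊗ₜ[ℂ] ((g.2 : ℂ) * l'))) =
    rhoO g (pf4 (u ⊗ₜ[ℂ] (l ⊗ₜ[ℂ] l')))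
  rw [pf4_tmul, pf4_tmul, map_smul, ← key, smul_smul]
  congr 1
  ring

theorem pfLin_equivariant (g : G) (t : Module.Dual ℂ V ⊗[ℂ] D) :
    pfLin (rhoV.dual.tprod rhoD g t) = rhoO g (pfLin t) := by
  rw [pfLin, LinearMap.comp_apply, contractD_equivariant, pf4_equivariant, LinearMap.comp_apply]

theorem pfLin_eDual_volD (i : Fin 5) : pfLin (eDual i ⊗ₜ[ℂ] volD) = pfaffian i := by
  have h : pfLin (eDual i ⊗ₜ[ℂ] volD) = ((1 : ℂ) * 1) •
      exteriorPower.alternatingMapLinearEquiv pfForm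
        (contract (eDual i ⊗ₜ[ℂ] exteriorPower.ιMulti ℂ 5 e)) := rfl
  rw [h, mul_one, one_smul, contract_tmul, Finset.sum_eq_single i]
  · rw [map_zsmul, map_smul, exteriorPower.alternatingMapLinearEquiv_apply_ιMulti]
    have h1 : eDual i (e i) = 1 := by simp [eDual, e]
    rw [h1, one_smul, zsmul_eq_mul]
    push_cast
    rfl
  · intro j _ hj
    have h1 : eDual i (e j) = 0 := by simp [eDual, e, hj.symm]
    rw [h1, zero_smul, smul_zero]
  · simp

/-! ### Equivariance of the universal map -/

theorem eDual_apply (i : Fin 5) (v : V) : eDual i v = v i := rfl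

/-- The canonical element ∑ eᵢ^∨ ⊗ eᵢ is invariant. This makes M and ᵗPf equivariant although both
are defined through a basis. -/
theorem sum_bilin_rhoV {N : Type*} [AddCommMonoid N] [Module ℂ N]
    (B : Module.Dual ℂ V →ₗ[ℂ] V →ₗ[ℂ] N) (g : G) :
    ∑ i, B (rhoV.dual g (eDual i)) (rhoV g (e i)) = ∑ i, B (eDual i) (e i) := by
  have h (j : Fin 5) : ∑ i, (rhoV g (e i)) j • rhoV.dual g (eDual i) = eDual j := by
    refine LinearMap.ext fun w => ?_
    obtain ⟨w, rfl⟩ : ∃ w', w = rhoV g w' := ⟨rhoV g⁻¹ w, by simp⟩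
    rw [LinearMap.sum_apply]
    simp only [LinearMap.smul_apply, rhoV_dual_apply, eDual_apply]
    conv_rhs => rw [vec_eq_sum w, map_sum]
    simp [mul_comm]
  calc ∑ i, B (rhoV.dual g (eDual i)) (rhoV g (e i))
      = ∑ i, ∑ j, (rhoV g (e i)) j • B (rhoV.dual g (eDual i)) (e j) := by
        refine Finset.sum_congr rfl fun i _ => ?_
        conv_lhs => rw [vec_eq_sum (rhoV g (e i)), map_sum]
        simp
    _ = ∑ j, ∑ i, (rhoV g (e i)) j • B (rhoV.dual g (eDual i)) (e j) := Finset.sum_comm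
    _ = ∑ j, B (eDual j) (e j) := by
        refine Finset.sum_congr rfl fun j _ => ?_
        conv_rhs => rw [← h j]
        simp [map_sum, LinearMap.sum_apply]

theorem univLin_tmul (v : V) (l : L) :
    univLin (v ⊗ₜ[ℂ] l) = ∑ i, x (e i) (l • v) ⊗ₜ[ℂ] eDual i := by
  simp [univLin, xLin]

theorem univLin_eval (v w : V) (l : L) :
    TensorProduct.rid ℂ O (LinearMap.lTensor O (Module.Dual.eval ℂ V w) (univLin (v ⊗ₜ[ℂ] l))) =
      SymmetricAlgebra.ι ℂ Lin (wedge w v ⊗ₜ[ℂ] l) := by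
  have h1 : x w (l • v) = SymmetricAlgebra.ι ℂ Lin (wedge w v ⊗ₜ[ℂ] l) := by
    have h2 : wedge w v ⊗ₜ[ℂ] l = l • (wedge w v ⊗ₜ[ℂ] (1 : L)) := by
      rw [← TensorProduct.tmul_smul, smul_eq_mul, mul_one]
    rw [x_smul_right, h2, map_smul]
    rfl
  have h3 : x w (l • v) = ∑ i, w i • x (e i) (l • v) := by
    rw [x_swap]
    have h4 := map_sum (xLin (l • v)) (fun i => w i • e i) Finset.univ
    rw [← vec_eq_sum w] at h4
    change -xLin (l • v) w = _
    rw [h4, ← Finset.sum_neg_distrib]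
    refine Finset.sum_congr rfl fun i _ => ?_
    rw [map_smul, x_swap, smul_neg]
    rfl
  rw [univLin_tmul, ← h1, h3, map_sum, map_sum]
  rfl

theorem univLin_equivariant (g : G) (t : V ⊗[ℂ] L) :
    univLin (rhoV.tprod rhoL g t) = rhoO.tprod rhoV.dual g (univLin t) := by
  suffices h : univLin ∘ₗ rhoV.tprod rhoL g = rhoO.tprod rhoV.dual g ∘ₗ univLin from
    LinearMap.congr_fun h t
  refine TensorProduct.ext' fun v l => ?_
  change univLin (rhoV g v ⊗ₜ[ℂ] ((g.2 : ℂ) * l)) = rhoO.tprod rhoV.dual g (univLin (v ⊗ₜ[ℂ] l))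
  rw [univLin_tmul, univLin_tmul, map_sum]
  -- The bilinear map is (φ, u) ↦ x(u, l·gv) ⊗ φ; the minus sign arises because `xLin` fixes the
  -- first argument of x.
  have hB := sum_bilin_rhoV ((TensorProduct.mk ℂ O (Module.Dual ℂ V)).flip.compl₂
    (-xLin (((g.2 : ℂ) * l) • rhoV g v))) g
  have hx (φ : Module.Dual ℂ V) (u : V) : (TensorProduct.mk ℂ O (Module.Dual ℂ V)).flip.compl₂
    (-xLin (((g.2 : ℂ) * l) • rhoV g v)) φ u = x u (((g.2 : ℂ) * l) • rhoV g v) ⊗ₜ[ℂ] φ := by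
    rw [x_swap]
    rfl
  simp only [hx] at hB
  rw [← hB]
  refine Finset.sum_congr rfl fun i _ => ?_
  change _ = rhoO g (x (e i) (l • v)) ⊗ₜ[ℂ] rhoV.dual g (eDual i)
  rw [rhoO_x, map_smul, mul_smul, x_smul_right]

/-! ### Bases of the terms of the complex -/

/-- The pairing with the wedge of the dual basis is the determinant of the identity matrix. -/
theorem iotaMulti_e_ne_zero : exteriorPower.ιMulti ℂ 5 e ≠ 0 := by
  intro h
  have h1 := congrArg (exteriorPower.pairingDual ℂ V 5 (exteriorPower.ιMulti ℂ 5 eDual)) h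
  rw [exteriorPower.pairingDual_ιMulti_ιMulti, map_zero] at h1
  have h2 : (Matrix.of fun i j => eDual j (e i)) = 1 := by
    ext i j
    by_cases hij : i = j <;> simp [eDual, e, Matrix.one_apply, hij]
  rw [h2, Matrix.det_one] at h1
  exact one_ne_zero h1

/-- The basis of the top exterior power given by the standard basis. -/
def topBasis : Module.Basis Unit ℂ (Ext 5) :=
  basisOfTopLeSpanOfCardEqFinrank (fun _ => exteriorPower.ιMulti ℂ 5 e)
    (by
      have h : Module.finrank ℂ (Ext 5) = 1 := by
        rw [exteriorPower.finrank_eq, Module.finrank_fin_fun]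
        decide
      rw [Set.range_const, (finrank_eq_one_iff_of_nonzero _ iotaMulti_e_ne_zero).1 h])
    (by
      rw [exteriorPower.finrank_eq, Module.finrank_fin_fun]
      decide)

theorem topBasis_apply (u : Unit) : topBasis u = exteriorPower.ιMulti ℂ 5 e := by
  rw [topBasis, coe_basisOfTopLeSpanOfCardEqFinrank]

/-- The basis of `D` given by the standard basis of `V`. -/
def dBasis : Module.Basis Unit ℂ D :=
  (topBasis.tensorProduct ((Module.Basis.singleton Unit ℂ).tensorProduct
    (Module.Basis.singleton Unit ℂ))).reindex ((Equiv.punitProd _).trans (Equiv.punitProd _))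

theorem dBasis_apply (u : Unit) : dBasis u = volD := by
  rw [dBasis, Module.Basis.reindex_apply, Module.Basis.tensorProduct_apply',
    Module.Basis.tensorProduct_apply', topBasis_apply, Module.Basis.singleton_apply]
  rfl

/-- The standard basis of `O ⊗ V^∨ ⊗ D`. -/
def f1Basis : Module.Basis (Fin 5) O F1 :=
  Algebra.TensorProduct.basis O (((Pi.basisFun ℂ (Fin 5)).dualBasis.tensorProduct dBasis).reindex
    (Equiv.prodPUnit (Fin 5)))

theorem f1Basis_apply (i : Fin 5) : f1Basis i = 1 ⊗ₜ[ℂ] (eDual i ⊗ₜ[ℂ] volD) := by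
  rw [f1Basis, Algebra.TensorProduct.basis_apply, Module.Basis.reindex_apply,
    Module.Basis.tensorProduct_apply', dBasis_apply]
  congr 2
  ext v
  simp [eDual]

/-- The standard basis of `O ⊗ V ⊗ L ⊗ D`. -/
def f2Basis : Module.Basis (Fin 5) O F2 :=
  Algebra.TensorProduct.basis O (((((Pi.basisFun ℂ (Fin 5)).tensorProduct
    (Module.Basis.singleton Unit ℂ)).reindex (Equiv.prodPUnit (Fin 5))).tensorProduct
      dBasis).reindex (Equiv.prodPUnit (Fin 5)))

theorem f2Basis_apply (i : Fin 5) :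
    f2Basis i = 1 ⊗ₜ[ℂ] ((e i ⊗ₜ[ℂ] (1 : L)) ⊗ₜ[ℂ] volD) := by
  rw [f2Basis, Algebra.TensorProduct.basis_apply, Module.Basis.reindex_apply,
    Module.Basis.tensorProduct_apply', dBasis_apply, Module.Basis.reindex_apply,
    Module.Basis.tensorProduct_apply', Module.Basis.singleton_apply, Pi.basisFun_apply]
  rfl

/-- The standard basis of `O ⊗ L ⊗ D²`. -/
def f3Basis : Module.Basis Unit O F3 :=
  Algebra.TensorProduct.basis O (((Module.Basis.singleton Unit ℂ).tensorProduct
    (dBasis.tensorProduct dBasis)).reindex ((Equiv.punitProd _).trans (Equiv.punitProd _)))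

theorem f3Basis_apply (u : Unit) :
    f3Basis u = 1 ⊗ₜ[ℂ] ((1 : L) ⊗ₜ[ℂ] (volD ⊗ₜ[ℂ] volD)) := by
  rw [f3Basis, Algebra.TensorProduct.basis_apply, Module.Basis.reindex_apply,
    Module.Basis.tensorProduct_apply', Module.Basis.tensorProduct_apply', dBasis_apply,
    Module.Basis.singleton_apply]

/-! ### The maps in coordinates -/

theorem mapPf_f1Basis (i : Fin 5) : mapPf (f1Basis i) = pfaffian i := by
  rw [f1Basis_apply, mapPf, LinearMap.liftBaseChange_tmul, one_smul, pfLin_eDual_volD]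

theorem mapM_f2Basis (j : Fin 5) : mapM (f2Basis j) = ∑ i, genericSkew i j • f1Basis i := by
  rw [f2Basis_apply, mapM, LinearMap.liftBaseChange_tmul, one_smul]
  change TensorProduct.assoc ℂ O (Module.Dual ℂ V) D
    (univLin (e j ⊗ₜ[ℂ] (1 : L)) ⊗ₜ[ℂ] volD) = _
  rw [univLin_tmul, one_smul, TensorProduct.sum_tmul, map_sum]
  refine Finset.sum_congr rfl fun i _ => ?_
  rw [f1Basis_apply, TensorProduct.assoc_tmul, TensorProduct.smul_tmul', smul_eq_mul, mul_one]
  rfl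

theorem mapPfT_tmul (a : O) (l : L) (d d' : D) :
    mapPfT (a ⊗ₜ[ℂ] (l ⊗ₜ[ℂ] (d ⊗ₜ[ℂ] d'))) =
      a • ∑ i, pfLin (eDual i ⊗ₜ[ℂ] d) ⊗ₜ[ℂ] ((e i ⊗ₜ[ℂ] l) ⊗ₜ[ℂ] d') := by
  rw [mapPfT, LinearMap.liftBaseChange_tmul, LinearMap.sum_apply]
  rfl

theorem mapPfT_f3Basis (u : Unit) : mapPfT (f3Basis u) = ∑ i, pfaffian i • f2Basis i := by
  rw [f3Basis_apply, mapPfT_tmul, one_smul]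
  refine Finset.sum_congr rfl fun i _ => ?_
  rw [f2Basis_apply, pfLin_eDual_volD, TensorProduct.smul_tmul', smul_eq_mul, mul_one]

theorem mapPf_sum (c : Fin 5 → O) :
    mapPf (∑ i, c i • f1Basis i) = ∑ i, c i * pfaffian i := by
  rw [map_sum]
  refine Finset.sum_congr rfl fun i _ => ?_
  rw [map_smul, mapPf_f1Basis, smul_eq_mul]

theorem mapM_sum (b : Fin 5 → O) :
    mapM (∑ j, b j • f2Basis j) = ∑ i, genericSkew.mulVec b i • f1Basis i := by
  rw [map_sum]
  simp only [map_smul, mapM_f2Basis, Finset.smul_sum, smul_smul, Matrix.mulVec, dotProduct,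
    Finset.sum_smul]
  rw [Finset.sum_comm]
  simp only [mul_comm]

theorem mapPfT_smul (t : O) :
    mapPfT (t • f3Basis ()) = ∑ i, (t • pfaffian) i • f2Basis i := by
  rw [map_smul, mapPfT_f3Basis, Finset.smul_sum]
  simp only [smul_smul, Pi.smul_apply, smul_eq_mul]

theorem exists_eq_sum_smul {T M ι : Type*} [CommRing T] [AddCommGroup M] [Module T M] [Fintype ι]
    (b : Module.Basis ι T M) (m : M) : ∃ c : ι → T, m = ∑ i, c i • b i :=
  ⟨b.equivFun m, (b.sum_equivFun m).symm⟩

theorem eq_of_sum_smul_eq {T M ι : Type*} [CommRing T] [AddCommGroup M] [Module T M] [Fintype ι]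
    (b : Module.Basis ι T M) {c c' : ι → T} (h : ∑ i, c i • b i = ∑ i, c' i • b i) : c = c' :=
  b.equivFun.symm.injective (by simpa only [Module.Basis.equivFun_symm_apply] using h)

/-! ### Exactness -/

theorem mapAug_surjective : Function.Surjective mapAug := Submodule.mkQ_surjective _

theorem exact_mapPf_mapAug : Function.Exact mapPf mapAug := by
  intro f
  have h : mapAug f = 0 ↔ f ∈ idealGr := Submodule.Quotient.mk_eq_zero _
  rw [h, idealGr_eq_span, Ideal.mem_span_range_iff_exists_fun]
  constructor
  · rintro ⟨c, rfl⟩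
    exact ⟨_, mapPf_sum c⟩
  · rintro ⟨m, rfl⟩
    obtain ⟨c, rfl⟩ := exists_eq_sum_smul f1Basis m
    exact ⟨c, (mapPf_sum c).symm⟩

theorem exact_mapM_mapPf : Function.Exact mapM mapPf := by
  intro m
  obtain ⟨c, rfl⟩ := exists_eq_sum_smul f1Basis m
  rw [mapPf_sum, sum_mul_pfaffian_eq_zero_iff]
  constructor
  · rintro ⟨b, rfl⟩
    exact ⟨_, mapM_sum b⟩
  · rintro ⟨n, hn⟩
    obtain ⟨b, rfl⟩ := exists_eq_sum_smul f2Basis n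
    rw [mapM_sum] at hn
    exact ⟨b, (eq_of_sum_smul_eq f1Basis hn).symm⟩

theorem exact_mapPfT_mapM : Function.Exact mapPfT mapM := by
  intro m
  obtain ⟨b, rfl⟩ := exists_eq_sum_smul f2Basis m
  have h : mapM (∑ i, b i • f2Basis i) = 0 ↔ genericSkew.mulVec b = 0 := by
    rw [mapM_sum]
    constructor
    · intro h
      refine eq_of_sum_smul_eq f1Basis (h.trans ?_)
      simp only [Pi.zero_apply, zero_smul, Finset.sum_const_zero]
    · intro h
      rw [h]
      simp only [Pi.zero_apply, zero_smul, Finset.sum_const_zero]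
  rw [h, genericSkew_mulVec_eq_zero_iff]
  constructor
  · rintro ⟨t, rfl⟩
    exact ⟨_, mapPfT_smul t⟩
  · rintro ⟨n, hn⟩
    obtain ⟨c, rfl⟩ := exists_eq_sum_smul f3Basis n
    rw [Fintype.sum_unique] at hn
    exact ⟨c (), (eq_of_sum_smul_eq f2Basis ((mapPfT_smul (c ())).symm.trans hn)).symm⟩

/-- `O` is a domain, through its polynomial coordinates, and one Pfaffian is nonzero. -/
theorem mapPfT_injective : Function.Injective mapPfT := by
  rw [injective_iff_map_eq_zero]
  intro n hn
  obtain ⟨c, rfl⟩ := exists_eq_sum_smul f3Basis n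
  rw [Fintype.sum_unique] at hn ⊢
  have h : c () = 0 := by
    refine eq_zero_of_smul_pfaffian_eq_zero _ (eq_of_sum_smul_eq f2Basis (c' := 0) ?_)
    refine (mapPfT_smul (c ())).symm.trans (hn.trans ?_)
    simp only [Pi.zero_apply, zero_smul, Finset.sum_const_zero]
  change c () • _ = 0
  rw [h, zero_smul]

/-! ### Equivariance -/

theorem isEquivariantModule_rhoO : IsEquivariantModule rhoO := fun g a m => rhoO_mul g a m

theorem isEquivariantModule_rhoOGr : IsEquivariantModule rhoOGr := by
  intro g a m
  obtain ⟨m, rfl⟩ := Ideal.Quotient.mk_surjective m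
  exact congrArg (Ideal.Quotient.mk idealGr) (rhoO_mul g a m)

theorem tprod_smul {k H A W : Type*} [CommSemiring k] [Monoid H] [CommSemiring A] [Algebra k A]
    [AddCommMonoid W] [Module k W] (ρ : Representation k H A) (σ : Representation k H W) (g : H)
    (hρ : ∀ a b, ρ g (a * b) = ρ g a * ρ g b) (a : A) (m : A ⊗[k] W) :
    ρ.tprod σ g (a • m) = ρ g a • ρ.tprod σ g m := by
  induction m using TensorProduct.induction_on with
  | zero => simp only [smul_zero, map_zero]
  | add m n hm hn => rw [smul_add, map_add, hm, hn, map_add, smul_add]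
  | tmul b w =>
    rw [TensorProduct.smul_tmul', smul_eq_mul, Representation.tprod_apply, TensorProduct.map_tmul,
      TensorProduct.map_tmul, hρ, TensorProduct.smul_tmul', smul_eq_mul]

/-- An `O`-linear map out of O ⊗ W is equivariant once it is so on the generators W, so each
differential is checked only on its finite-dimensional representation. -/
theorem liftBaseChange_tprod {k H A W N : Type*} [CommSemiring k] [Monoid H] [CommSemiring A]
    [Algebra k A] [AddCommMonoid W] [Module k W] [AddCommMonoid N] [Module k N] [Module A N]
    [IsScalarTower k A N]
    (ρ : Representation k H A) (σ : Representation k H W) (τ : Representation k H N) (g : H)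
    (hτ : ∀ (a : A) n, τ g (a • n) = ρ g a • τ g n) (f : W →ₗ[k] N)
    (hf : ∀ w, f (σ g w) = τ g (f w)) (m : A ⊗[k] W) :
    LinearMap.liftBaseChange A f (ρ.tprod σ g m) = τ g (LinearMap.liftBaseChange A f m) := by
  induction m using TensorProduct.induction_on with
  | zero => simp only [map_zero]
  | add m n hm hn => rw [map_add, map_add, hm, hn, map_add, map_add]
  | tmul b w =>
    rw [Representation.tprod_apply, TensorProduct.map_tmul, LinearMap.liftBaseChange_tmul,
      LinearMap.liftBaseChange_tmul, hf, hτ]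

theorem isEquivariantModule_rhoF1 : IsEquivariantModule rhoF1 :=
  fun g a m => tprod_smul rhoO (rhoV.dual.tprod rhoD) g (rhoO_mul g) a m

theorem isEquivariantModule_rhoF2 : IsEquivariantModule rhoF2 :=
  fun g a m => tprod_smul rhoO ((rhoV.tprod rhoL).tprod rhoD) g (rhoO_mul g) a m

theorem isEquivariantModule_rhoF3 : IsEquivariantModule rhoF3 :=
  fun g a m => tprod_smul rhoO (rhoL.tprod (rhoD.tprod rhoD)) g (rhoO_mul g) a m

theorem isEquivariantMap_mapAug : IsEquivariantMap rhoO rhoOGr mapAug := fun _ _ => rfl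

theorem isEquivariantMap_mapPf : IsEquivariantMap rhoF1 rhoO mapPf :=
  fun g m => liftBaseChange_tprod rhoO (rhoV.dual.tprod rhoD) rhoO g (rhoO_mul g) pfLin
    (pfLin_equivariant g) m

theorem assoc_tprod {k H A B C : Type*} [CommSemiring k] [Monoid H] [AddCommMonoid A] [Module k A]
    [AddCommMonoid B] [Module k B] [AddCommMonoid C] [Module k C] (ρ : Representation k H A)
    (σ : Representation k H B) (τ : Representation k H C) (g : H) (t : A ⊗[k] B) (c : C) :
    TensorProduct.assoc k A B C (ρ.tprod σ g t ⊗ₜ[k] τ g c) =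
      ρ.tprod (σ.tprod τ) g (TensorProduct.assoc k A B C (t ⊗ₜ[k] c)) := by
  induction t using TensorProduct.induction_on with
  | zero => simp only [map_zero, TensorProduct.zero_tmul]
  | add m n hm hn => simp only [map_add, TensorProduct.add_tmul, hm, hn]
  | tmul a b => rfl

/-- The linear map inducing `M`. -/
def mapMLin : (V ⊗[ℂ] L) ⊗[ℂ] D →ₗ[ℂ] F1 :=
  (TensorProduct.assoc ℂ O (Module.Dual ℂ V) D).toLinearMap
    ∘ₗ TensorProduct.map univLin LinearMap.id

theorem isEquivariantMap_mapM : IsEquivariantMap rhoF2 rhoF1 mapM := by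
  intro g m
  refine liftBaseChange_tprod rhoO ((rhoV.tprod rhoL).tprod rhoD) rhoF1 g
    (isEquivariantModule_rhoF1 g) (mapMLin) (fun w => ?_) m
  suffices h : mapMLin ∘ₗ (rhoV.tprod rhoL).tprod rhoD g = rhoF1 g ∘ₗ mapMLin from
    LinearMap.congr_fun h w
  refine TensorProduct.ext' fun t d => ?_
  change TensorProduct.assoc ℂ O (Module.Dual ℂ V) D
    (univLin (rhoV.tprod rhoL g t) ⊗ₜ[ℂ] rhoD g d) = rhoO.tprod (rhoV.dual.tprod rhoD) g
      (TensorProduct.assoc ℂ O (Module.Dual ℂ V) D (univLin t ⊗ₜ[ℂ] d))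
  rw [univLin_equivariant, assoc_tprod]

theorem sum_pfLin_equivariant (g : G) (l : L) (d d' : D) :
    ∑ i, pfLin (eDual i ⊗ₜ[ℂ] rhoD g d) ⊗ₜ[ℂ] ((e i ⊗ₜ[ℂ] rhoL g l) ⊗ₜ[ℂ] rhoD g d') =
      rhoF2 g (∑ i, pfLin (eDual i ⊗ₜ[ℂ] d) ⊗ₜ[ℂ] ((e i ⊗ₜ[ℂ] l) ⊗ₜ[ℂ] d')) := by
  -- With d, d', l already moved by g, the sum is a bilinear expression in ∑ eᵢ^∨ ⊗ eᵢ; moving the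
  -- basis too makes each summand g applied to the original one.
  have hB := sum_bilin_rhoV (((TensorProduct.mk ℂ O ((V ⊗[ℂ] L) ⊗[ℂ] D)).compl₁₂
    (pfLin ∘ₗ (TensorProduct.mk ℂ (Module.Dual ℂ V) D).flip (rhoD g d))
    ((TensorProduct.mk ℂ (V ⊗[ℂ] L) D).flip (rhoD g d') ∘ₗ
      (TensorProduct.mk ℂ V L).flip (rhoL g l)))) g
  refine hB.symm.trans ?_
  rw [map_sum]
  refine Finset.sum_congr rfl fun i _ => ?_
  change pfLin (rhoV.dual.tprod rhoD g (eDual i ⊗ₜ[ℂ] d)) ⊗ₜ[ℂ] _ = _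
  rw [pfLin_equivariant]
  rfl

/-- The linear map inducing `ᵗPf`. -/
def mapPfTLin : L ⊗[ℂ] (D ⊗[ℂ] D) →ₗ[ℂ] F2 :=
  ∑ i : Fin 5,
    (TensorProduct.map
        (pfLin ∘ₗ TensorProduct.mk ℂ (Module.Dual ℂ V) D (eDual i))
        (TensorProduct.map (TensorProduct.mk ℂ V L (e i)) LinearMap.id)
      ∘ₗ (TensorProduct.leftComm ℂ L D D).toLinearMap)

theorem mapPfTLin_tmul (l : L) (d d' : D) :
    mapPfTLin (l ⊗ₜ[ℂ] (d ⊗ₜ[ℂ] d')) =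
      ∑ i, pfLin (eDual i ⊗ₜ[ℂ] d) ⊗ₜ[ℂ] ((e i ⊗ₜ[ℂ] l) ⊗ₜ[ℂ] d') := by
  rw [mapPfTLin, LinearMap.sum_apply]
  rfl

theorem isEquivariantMap_mapPfT : IsEquivariantMap rhoF3 rhoF2 mapPfT := by
  intro g m
  refine liftBaseChange_tprod rhoO (rhoL.tprod (rhoD.tprod rhoD)) rhoF2 g
    (isEquivariantModule_rhoF2 g) mapPfTLin (fun w => ?_) m
  suffices h : mapPfTLin ∘ₗ rhoL.tprod (rhoD.tprod rhoD) g = rhoF2 g ∘ₗ mapPfTLin from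
    LinearMap.congr_fun h w
  refine TensorProduct.ext' fun l s => ?_
  suffices h : mapPfTLin ∘ₗ rhoL.tprod (rhoD.tprod rhoD) g ∘ₗ TensorProduct.mk ℂ _ _ l =
      rhoF2 g ∘ₗ mapPfTLin ∘ₗ TensorProduct.mk ℂ _ _ l from LinearMap.congr_fun h s
  refine TensorProduct.ext' fun d d' => ?_
  change mapPfTLin (rhoL g l ⊗ₜ[ℂ] (rhoD g d ⊗ₜ[ℂ] rhoD g d')) =
    rhoF2 g (mapPfTLin (l ⊗ₜ[ℂ] (d ⊗ₜ[ℂ] d')))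
  rw [mapPfTLin_tmul, mapPfTLin_tmul]
  exact sum_pfLin_equivariant g l d d'

end AffGr

end

theorem proposition2p1 :
    -- the universal map `V ⊗ L → O ⊗ V^∨` is given by the tautological skew form
    (∀ (v w : V) (l : L),
      TensorProduct.rid ℂ O
          (LinearMap.lTensor O (Module.Dual.eval ℂ V w) (univLin (v ⊗ₜ[ℂ] l)))
        = SymmetricAlgebra.ι ℂ Lin (wedge w v ⊗ₜ[ℂ] l)) ∧
    -- `V^∨ ⊗ D = ⋀⁴V ⊗ L²`, equivariantly
    Function.Bijective contractD ∧
    (∀ (g : G) (t : Module.Dual ℂ V ⊗[ℂ] D),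
      contractD (rhoV.dual.tprod rhoD g t)
        = (rhoExt 4).tprod (rhoL.tprod rhoL) g (contractD t)) ∧
    -- `2 Pf` is the wedge square of the universal skew form
    ((2 : ℂ) • pfForm = ((LinearMap.mul' ℂ O).compAlternatingMap
      (xForm.domCoprod xForm)).domDomCongr finSumFinEquiv) ∧
    -- in coordinates: the generic skew matrix, its vector of Pfaffians and the transposed vector
    (∀ i, mapPf (1 ⊗ₜ[ℂ] (eDual i ⊗ₜ[ℂ] volD)) = pfaffian i) ∧
    (∀ j, mapM (1 ⊗ₜ[ℂ] ((e j ⊗ₜ[ℂ] (1 : L)) ⊗ₜ[ℂ] volD))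
      = ∑ i, genericSkew i j • ((1 : O) ⊗ₜ[ℂ] (eDual i ⊗ₜ[ℂ] volD))) ∧
    (mapPfT (1 ⊗ₜ[ℂ] ((1 : L) ⊗ₜ[ℂ] (volD ⊗ₜ[ℂ] volD)))
      = ∑ i, pfaffian i • ((1 : O) ⊗ₜ[ℂ] ((e i ⊗ₜ[ℂ] (1 : L)) ⊗ₜ[ℂ] volD))) ∧
    -- the terms are equivariant modules, and free of ranks 1, 5, 5, 1
    (IsEquivariantModule rhoOGr ∧ IsEquivariantModule rhoO ∧ IsEquivariantModule rhoF1 ∧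
      IsEquivariantModule rhoF2 ∧ IsEquivariantModule rhoF3) ∧
    (Module.Free O F1 ∧ Module.finrank O F1 = 5) ∧
    (Module.Free O F2 ∧ Module.finrank O F2 = 5) ∧
    (Module.Free O F3 ∧ Module.finrank O F3 = 1) ∧
    -- the maps are equivariant
    (IsEquivariantMap rhoO rhoOGr mapAug ∧ IsEquivariantMap rhoF1 rhoO mapPf ∧
      IsEquivariantMap rhoF2 rhoF1 mapM ∧ IsEquivariantMap rhoF3 rhoF2 mapPfT) ∧
    -- the complex is a resolution of the coordinate ring of the affine cone
    (Function.Surjective mapAug ∧ Function.Exact mapPf mapAug ∧ Function.Exact mapM mapPf ∧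
      Function.Exact mapPfT mapM ∧ Function.Injective mapPfT) ∧
    -- the ideal of the affine cone is generated by the Pfaffians, with syzygy matrix `M`
    idealGr = Ideal.span (Set.range pfaffian) ∧
    (∀ c : Fin 5 → O, ∑ i, c i * pfaffian i = 0 ↔ ∃ b, c = genericSkew.mulVec b) :=
  ⟨univLin_eval, contractD_bijective, contractD_equivariant, two_smul_pfForm,
    fun i => by rw [← f1Basis_apply, mapPf_f1Basis],
    fun j => by simp only [← f2Basis_apply, mapM_f2Basis, f1Basis_apply],
    by rw [← f3Basis_apply (), mapPfT_f3Basis]; simp only [f2Basis_apply],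
    ⟨isEquivariantModule_rhoOGr, isEquivariantModule_rhoO, isEquivariantModule_rhoF1,
      isEquivariantModule_rhoF2, isEquivariantModule_rhoF3⟩,
    ⟨.of_basis f1Basis, Module.finrank_eq_card_basis f1Basis⟩,
    ⟨.of_basis f2Basis, Module.finrank_eq_card_basis f2Basis⟩,
    ⟨.of_basis f3Basis, Module.finrank_eq_card_basis f3Basis⟩,
    ⟨isEquivariantMap_mapAug, isEquivariantMap_mapPf, isEquivariantMap_mapM,
      isEquivariantMap_mapPfT⟩,
    ⟨mapAug_surjective, exact_mapPf_mapAug, exact_mapM_mapPf, exact_mapPfT_mapM,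
      mapPfT_injective⟩,
    idealGr_eq_span, sum_mul_pfaffian_eq_zero_iff⟩
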